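/- Let $n\ge 1$ parties be given, of which $k\ge 1$ are honest and the other $n-k$ are dishonest; the dishonest parties collude and control the source. Write $\Delta(y)$ for the Hamming weight of $y\in\{0,1\}^n$, and let $$|\Phi_0^n\rangle=\frac1{\sqrt{2^{n-1}}}\Big[\sum_{\Delta(y)\equiv 0\,(4)}|y\rangle-\sum_{\Delta(y)\equiv 2\,(4)}|y\rangle\Big]$$ be the $n$-party GHZ state (up to local unitaries). Test $V$ with verifier $i$, on a state $|\Psi\rangle$: the verifier draws inputs $X\in\{0,1\}^n$ uniformly among those with $\sum_j X_j\equiv 0\pmod 2$ and sends $X_j$ privately to party $j$. Each honest party $j$ applies $Z$ to its qubit if $X_j=0$ and a Hadamard gate if $X_j=1$, measures in the computational basis and sends the outcome $Y_j$ privately to the verifier. The dishonest parties announce their bits $Y_j$ as the outcome of an arbitrary joint measurement (POVM) of their space, which may depend on their own inputs. The verifier accepts if and only if $\sum_j Y_j\equiv\frac12\sum_j X_j\pmod 2$. If the verifier is dishonest, the test is deemed to be passed. Symmetric protocol with security parameter $S\in\mathbb N$: in each repetition, (1) the source distributes a pure state $|\Psi\rangle$, in which each honest party holds one qubit, while the dishonest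 parties hold $n-k$ qubits and an auxiliary system of arbitrary finite dimension; (2) a trusted common random source then gives to all parties independent uniform $r\in\{0,1\}^S$ and $i\in\{1,\dots,n\}$. If $r=0\cdots0$, the state $|\Psi\rangle$ is used for computation and the protocol ends. If $r\ne 0\cdots 0$, party $i$ runs $V$ on $|\Psi\rangle$; if it rejects, the protocol aborts, otherwise a new repetition starts. The adversary's state and measurements may be random, may differ in every repetition and may depend on everything that happened in earlier repetitions; the measurement may also depend on $r$ and $i$. For $\varepsilon>0$ let $C_\varepsilon$ be the event that the protocol ends without abort by using a state $|\Psi\rangle$ with $\min_U D(U|\Psi\rangle,|\Phi_0^n\rangle)\ge\varepsilon$, where $D$ is the trace distance, $U$ ranges over the unitaries on the space of the dishonest parties (their qubits and the auxiliary system), and $|\Phi_0^n\rangle$ is understood as tensored with a fixed pure state of the auxiliary system. Then for every adversary and every $\varepsilon>0$, $$\Pr[C_\varepsilon]\le 2^{-S}\,\frac{4n}{k\varepsilon^2}.$$ -/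

import Mathlib

open scoped ENNReal Kronecker ComplexOrder

namespace GHZ

noncomputable section

/-! ## Qubit registers and the GHZ state -/

/-- Bit strings indexed by `ι`; they label the computational basis of one qubit per `j : ι`. -/
abbrev Bits (ι : Type) : Type := ι → Fin 2

/-- Hamming weight of a bit string. -/
def wt {ι : Type} [Fintype ι] (y : Bits ι) : ℕ := ∑ j, (y j : ℕ)

/-- The `n`-qubit state `|Φ₀ⁿ⟩`: amplitude `1/√(2^(n-1))` on strings of weight `0 mod 4`, the
opposite amplitude on strings of weight `2 mod 4`, and `0` on strings of odd weight. -/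
def ghz (n : ℕ) : Bits (Fin n) → ℂ := fun y =>
  if wt y % 4 = 0 then (((√((2 : ℝ) ^ (n - 1)))⁻¹ : ℝ) : ℂ)
  else if wt y % 4 = 2 then -(((√((2 : ℝ) ^ (n - 1)))⁻¹ : ℝ) : ℂ)
  else 0

/-! ## Trace distance -/

/-- The rank-one operator `|ψ⟩⟨ψ|`. -/
def ketbra {ι : Type} (ψ : ι → ℂ) : Matrix ι ι ℂ := Matrix.vecMulVec ψ (star ψ)

theorem ketbra_isHermitian {ι : Type} (ψ : ι → ℂ) : (ketbra ψ).IsHermitian := by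
  ext a b
  simp [ketbra, Matrix.vecMulVec_apply, mul_comm]

/-- Trace distance `½ ‖ρ - σ‖₁` of two Hermitian operators; the trace norm of a Hermitian operator
is the sum of the absolute values of its eigenvalues. -/
def traceDist {ι : Type} [Fintype ι] [DecidableEq ι] {ρ σ : Matrix ι ι ℂ}
    (hρ : ρ.IsHermitian) (hσ : σ.IsHermitian) : ℝ :=
  (1 / 2) * ∑ a, |(hρ.sub hσ).eigenvalues a|

/-- Trace distance of two pure states. -/
def pureDist {ι : Type} [Fintype ι] [DecidableEq ι] (ψ φ : ι → ℂ) : ℝ :=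
  traceDist (ketbra_isHermitian ψ) (ketbra_isHermitian φ)

/-! ## Honest measurements -/

/-- The operation performed on one qubit on input `x`: `Z` if `x = 0`, Hadamard if `x = 1`. -/
def gate (x : Fin 2) : Matrix (Fin 2) (Fin 2) ℂ :=
  if x = 0 then !![1, 0; 0, -1]
  else (((√2)⁻¹ : ℝ) : ℂ) • !![1, 1; 1, -1]

/-- The tensor product of the one-qubit operations prescribed by the input string `x`. -/
def gates {ι : Type} [Fintype ι] (x : Bits ι) : Matrix (Bits ι) (Bits ι) ℂ :=
  fun y z => ∏ j, gate (x j) (y j) (z j)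

/-! ## The parties

There are `n` parties, of which those in `H` are honest. -/

/-- Labels for the basis of the honest qubits. -/
abbrev HonestIdx {n : ℕ} (H : Finset (Fin n)) : Type := Bits {j : Fin n // j ∈ H}

/-- Labels for the basis of the space of the dishonest parties: their qubits together with an
auxiliary system of dimension `d + 1`. -/
abbrev DishonestIdx {n : ℕ} (H : Finset (Fin n)) (d : ℕ) : Type :=
  Bits {j : Fin n // j ∉ H} × Fin (d + 1)

/-- The bits of the honest parties in a string indexed by all parties. -/
def honestPart {n : ℕ} (H : Finset (Fin n)) (x : Bits (Fin n)) : Bits {j : Fin n // j ∈ H} :=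
  fun j => x j

/-- The bits of the dishonest parties in a string indexed by all parties. -/
def dishonestPart {n : ℕ} (H : Finset (Fin n)) (x : Bits (Fin n)) : Bits {j : Fin n // j ∉ H} :=
  fun j => x j

/-- The string indexed by all parties with given honest and dishonest bits. -/
def join {n : ℕ} (H : Finset (Fin n)) (u : Bits {j : Fin n // j ∈ H})
    (v : Bits {j : Fin n // j ∉ H}) : Bits (Fin n) :=
  fun j => if hj : j ∈ H then u ⟨j, hj⟩ else v ⟨j, hj⟩

/-- `|Φ₀ⁿ⟩` shared by all parties, with the auxiliary system in the fixed basis state `|0⟩`. -/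
def target {n : ℕ} (H : Finset (Fin n)) (d : ℕ) : HonestIdx H × DishonestIdx H d → ℂ :=
  fun p => if p.2.2 = 0 then ghz n (join H p.1 p.2.1) else 0

/-- `min_U D(U|Ψ⟩, |Φ₀ⁿ⟩)`, with `U` ranging over the unitaries on the dishonest space. -/
def localDist {n : ℕ} (H : Finset (Fin n)) (d : ℕ) (Ψ : HonestIdx H × DishonestIdx H d → ℂ) : ℝ :=
  ⨅ U : Matrix.unitaryGroup (DishonestIdx H d) ℂ,
    pureDist (((1 : Matrix (HonestIdx H) (HonestIdx H) ℂ) ⊗ₖ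
      (U : Matrix (DishonestIdx H d) (DishonestIdx H d) ℂ)).mulVec Ψ) (target H d)

/-- A generalized measurement (POVM) with outcomes in `β` on the space with basis `ι`. -/
structure Povm (ι β : Type) [Fintype ι] [DecidableEq ι] [Fintype β] where
  effect : β → Matrix ι ι ℂ
  posSemidef : ∀ b, (effect b).PosSemidef
  sum_eq_one : ∑ b, effect b = 1

/-- What the adversary does in one repetition: the pure state distributed by the source, and the
joint measurement which the dishonest parties use to produce their announced bits. The measurement
may depend on the common random string `r`, on the verifier `i`, and on the inputs that the
verifier sent to the dishonest parties. -/
structure Attack (n S : ℕ) (H : Finset (Fin n)) where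
  d : ℕ
  state : HonestIdx H × DishonestIdx H d → ℂ
  normalized : star state ⬝ᵥ state = 1
  meas : Bits (Fin S) → Fin n → Bits {j : Fin n // j ∉ H} →
    Povm (DishonestIdx H d) (Bits {j : Fin n // j ∉ H})

namespace Attack

variable {n S : ℕ} {H : Finset (Fin n)}

/-- The global state after the honest parties performed the operations prescribed by `x`. -/
def rotated (A : Attack n S H) (x : Bits (Fin n)) : HonestIdx H × DishonestIdx H A.d → ℂ :=
  (gates (honestPart H x) ⊗ₖ
    (1 : Matrix (DishonestIdx H A.d) (DishonestIdx H A.d) ℂ)).mulVec A.state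

/-- Born rule: the probability that on inputs `x` the honest parties, measuring in the computational
basis, obtain `u`, while the dishonest parties announce `v`. -/
def bornProb (A : Attack n S H) (r : Bits (Fin S)) (i : Fin n) (x : Bits (Fin n))
    (u : Bits {j : Fin n // j ∈ H}) (v : Bits {j : Fin n // j ∉ H}) : ℝ :=
  (star (fun b => A.rotated x (u, b)) ⬝ᵥ
    ((A.meas r i (dishonestPart H x)).effect v).mulVec (fun b => A.rotated x (u, b))).re

end Attack

/-! ### The Born rule defines a probability distribution -/

theorem gate_unitary (x : Fin 2) : (gate x).conjTranspose * gate x = 1 := by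
  have h2 : (((√2)⁻¹ : ℝ) : ℂ) * (((√2)⁻¹ : ℝ) : ℂ) = 1 / 2 := by
    rw [← Complex.ofReal_mul, ← mul_inv, Real.mul_self_sqrt (by norm_num)]
    norm_num
  ext a b
  fin_cases x <;> fin_cases a <;> fin_cases b <;>
    simp [gate, Matrix.mul_apply, Fin.sum_univ_two, -Complex.ofReal_inv, h2] <;> norm_num

theorem gates_unitary {ι : Type} [Fintype ι] [DecidableEq ι] (x : Bits ι) :
    (gates x).conjTranspose * gates x = 1 := by
  ext a b
  have h1 : ∀ j, ∑ y : Fin 2, star (gate (x j) y (a j)) * gate (x j) y (b j)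
      = if a j = b j then 1 else 0 := by
    intro j
    have := congrFun (congrFun (gate_unitary (x j)) (a j)) (b j)
    simpa [Matrix.mul_apply, Matrix.one_apply] using this
  calc ((gates x).conjTranspose * gates x) a b
      = ∑ y : ι → Fin 2, ∏ j, (star (gate (x j) (y j) (a j)) * gate (x j) (y j) (b j)) := by
        simp [Matrix.mul_apply, gates, Finset.prod_mul_distrib]
    _ = ∏ j, ∑ y : Fin 2, star (gate (x j) y (a j)) * gate (x j) y (b j) := by
        rw [Finset.prod_univ_sum, Fintype.piFinset_univ]
    _ = (1 : Matrix (Bits ι) (Bits ι) ℂ) a b := by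
        simp only [h1]
        by_cases hab : a = b
        · subst hab
          simp
        · obtain ⟨j, hj⟩ := Function.ne_iff.mp hab
          rw [Matrix.one_apply_ne hab]
          exact Finset.prod_eq_zero (Finset.mem_univ j) (by simp [hj])

namespace Attack

variable {n S : ℕ} {H : Finset (Fin n)}

theorem bornProb_nonneg (A : Attack n S H) (r : Bits (Fin S)) (i : Fin n) (x : Bits (Fin n))
    (u : Bits {j : Fin n // j ∈ H}) (v : Bits {j : Fin n // j ∉ H}) :
    0 ≤ A.bornProb r i x u v :=
  ((A.meas r i (dishonestPart H x)).posSemidef v).re_dotProduct_nonneg _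

theorem rotated_normalized (A : Attack n S H) (x : Bits (Fin n)) :
    star (A.rotated x) ⬝ᵥ A.rotated x = 1 := by
  unfold rotated
  rw [Matrix.star_mulVec, Matrix.dotProduct_mulVec, Matrix.vecMul_vecMul,
    Matrix.conjTranspose_kronecker, ← Matrix.mul_kronecker_mul, gates_unitary]
  simp [A.normalized]

theorem bornProb_sum (A : Attack n S H) (r : Bits (Fin S)) (i : Fin n) (x : Bits (Fin n)) :
    ∑ u, ∑ v, A.bornProb r i x u v = 1 := by
  have h1 : ∀ u, ∑ v, A.bornProb r i x u v
      = (star (fun b => A.rotated x (u, b)) ⬝ᵥ (fun b => A.rotated x (u, b))).re := by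
    intro u
    simp only [bornProb]
    rw [← Complex.re_sum, ← dotProduct_sum, ← Matrix.sum_mulVec,
      (A.meas r i (dishonestPart H x)).sum_eq_one, Matrix.one_mulVec]
  simp only [h1]
  rw [← Complex.re_sum]
  have h2 := A.rotated_normalized x
  simp only [dotProduct, Fintype.sum_prod_type, Pi.star_apply] at h2 ⊢
  rw [h2, Complex.one_re]

end Attack

/-! ## Protocol `V` -/

/-- The verifier's choice of inputs: uniform among the strings `x` with `∑ xᵢ ≡ 0 (mod 2)`. -/
def verifierInputs (n : ℕ) : PMF (Bits (Fin n)) :=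
  PMF.uniformOfFinset (Finset.univ.filter fun x => wt x % 2 = 0) ⟨fun _ => 0,
    Finset.mem_filter.mpr ⟨Finset.mem_univ _, by simp [wt]⟩⟩

/-- The verifier accepts iff `∑ yᵢ ≡ ½ ∑ xᵢ (mod 2)`. -/
def Accepts {n : ℕ} (x y : Bits (Fin n)) : Prop := wt y ≡ wt x / 2 [MOD 2]

theorem sum_join {n : ℕ} (H : Finset (Fin n)) (f : Bits {j : Fin n // j ∈ H} →
    Bits {j : Fin n // j ∉ H} → ℝ) :
    ∑ y : Bits (Fin n), f (honestPart H y) (dishonestPart H y) = ∑ u, ∑ v, f u v := by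
  rw [← Fintype.sum_prod_type' (f := f)]
  exact (Equiv.piEquivPiSubtypeProd (fun j => j ∈ H) (fun _ => Fin 2)).sum_comp
    (fun p => f p.1 p.2)

/-- Distribution of the outcomes `y` sent to an honest verifier `i` on inputs `x`. -/
def Attack.outcomes {n S : ℕ} {H : Finset (Fin n)} (A : Attack n S H) (r : Bits (Fin S))
    (i : Fin n) (x : Bits (Fin n)) : PMF (Bits (Fin n)) :=
  PMF.ofFintype
    (fun y => ENNReal.ofReal (A.bornProb r i x (honestPart H y) (dishonestPart H y))) (by
      rw [← ENNReal.ofReal_sum_of_nonneg fun y _ => A.bornProb_nonneg r i x _ _,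
        sum_join H (A.bornProb r i x), A.bornProb_sum, ENNReal.ofReal_one])

/-! ## The symmetric protocol -/

/-- Everything that happened in one repetition in which the state was tested: the adversary's
action, the values `r`, `i` of the common random source, and, if the verifier was honest, the
inputs and outcomes of all parties. -/
structure Round (n S : ℕ) (H : Finset (Fin n)) where
  attack : Attack n S H
  r : Bits (Fin S)
  i : Fin n
  transcript : Option (Bits (Fin n) × Bits (Fin n))

/-- A strategy of the adversary: a possibly random choice of the action in the next repetition,
which may depend on everything that happened in the previous ones. -/
abbrev Strategy (n S : ℕ) (H : Finset (Fin n)) : Type := List (Round n S H) → PMF (Attack n S H)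

/-- Status of the protocol: still running after the given tested repetitions, aborted, or finished
by using the state of the given action for the computation. -/
inductive Status (n S : ℕ) (H : Finset (Fin n)) where
  | running (past : List (Round n S H))
  | aborted
  | used (A : Attack n S H)

open Classical in
/-- One repetition. The source distributes the state first; then `r` and `i` are drawn uniformly by
the common random source. If `r = 0`, the state is used. Otherwise party `i` runs the test; a test
with a dishonest verifier always passes. -/
def step {n S : ℕ} [NeZero n] {H : Finset (Fin n)} (adv : Strategy n S H) :
    Status n S H → PMF (Status n S H)
  | .aborted => PMF.pure .aborted
  | .used A => PMF.pure (.used A)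
  | .running past =>
    (adv past).bind fun A =>
    (PMF.uniformOfFintype (Bits (Fin S))).bind fun r =>
    (PMF.uniformOfFintype (Fin n)).bind fun i =>
    if r = 0 then PMF.pure (.used A)
    else if i ∈ H then
      (verifierInputs n).bind fun x =>
      (A.outcomes r i x).bind fun y =>
      if Accepts x y then PMF.pure (.running (past ++ [⟨A, r, i, some (x, y)⟩]))
      else PMF.pure .aborted
    else PMF.pure (.running (past ++ [⟨A, r, i, none⟩]))

/-- Distribution of the status after `N` repetitions. -/
def run {n S : ℕ} [NeZero n] {H : Finset (Fin n)} (adv : Strategy n S H) : ℕ → PMF (Status n S H)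
  | 0 => PMF.pure (.running [])
  | N + 1 => (run adv N).bind (step adv)

/-- The protocol has ended without abort, using a state at distance at least `ε` from the GHZ state
up to unitaries on the dishonest space. -/
def BadUse {n S : ℕ} (H : Finset (Fin n)) (ε : ℝ) : Set (Status n S H) :=
  {s | ∃ A : Attack n S H, s = .used A ∧ ε ≤ localDist H A.d A.state}

/-- `Pr[C_ε]`: the event `C_ε` is the increasing union over `N` of the events that it has occurred
within the first `N` repetitions. -/
def probC {n S : ℕ} [NeZero n] {H : Finset (Fin n)} (adv : Strategy n S H) (ε : ℝ) : ℝ≥0∞ :=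
  ⨆ N : ℕ, (run adv N).toOuterMeasure (BadUse H ε)

end

end GHZ

namespace GHZ

/-! ## Phases of bit strings -/

theorem pow_wt_eq_prod {ι R : Type} [Fintype ι] [CommMonoid R] (c : R) (y : Bits ι) :
    c ^ wt y = ∏ j, c ^ (y j : ℕ) :=
  (Finset.prod_pow_eq_pow_sum _ _ _).symm

section Phases

variable {ι : Type} [Fintype ι] [DecidableEq ι]

theorem sum_bits_prod {R : Type} [CommSemiring R] (f : ι → Fin 2 → R) :
    ∑ y : Bits ι, ∏ j, f j (y j) = ∏ j, ∑ a, f j a := by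
  rw [Finset.prod_univ_sum, Fintype.piFinset_univ]

theorem sum_neg_one_pow_wt {R : Type} [CommRing R] [Nonempty ι] :
    ∑ y : Bits ι, (-1 : R) ^ wt y = 0 := by
  simp only [pow_wt_eq_prod]
  rw [sum_bits_prod (fun _ a => (-1 : R) ^ (a : ℕ))]
  simp [Fin.sum_univ_two]

theorem sum_gate_phase (z z' : Fin 2) :
    ∑ x : Fin 2, ∑ u : Fin 2, Complex.I ^ (x : ℕ) * ((-1) ^ (u : ℕ) *
      (star (gate x u z) * gate x u z')) = Complex.I ^ (z : ℕ) * Complex.I ^ (z' : ℕ) := by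
  have h2 : (((√2)⁻¹ : ℝ) : ℂ) * (((√2)⁻¹ : ℝ) : ℂ) = 1 / 2 := by
    rw [← Complex.ofReal_mul, ← mul_inv, Real.mul_self_sqrt (by norm_num)]
    norm_num
  fin_cases z <;> fin_cases z' <;>
    simp [gate, Fin.sum_univ_two, -Complex.ofReal_inv, h2] <;> ring_nf

theorem sum_gates_phase (z z' : Bits ι) :
    ∑ x : Bits ι, ∑ u : Bits ι, Complex.I ^ wt x * ((-1) ^ wt u *
      (star (gates x u z) * gates x u z')) = Complex.I ^ wt z * Complex.I ^ wt z' := by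
  have h : ∀ x u : Bits ι, Complex.I ^ wt x * ((-1) ^ wt u *
      (star (gates x u z) * gates x u z')) = ∏ j, Complex.I ^ (x j : ℕ) * ((-1) ^ (u j : ℕ) *
      (star (gate (x j) (u j) (z j)) * gate (x j) (u j) (z' j))) := by
    intro x u
    simp [pow_wt_eq_prod, gates, Finset.prod_mul_distrib]
  simp only [h]
  have h' : ∀ x : Bits ι, ∑ u : Bits ι, ∏ j, Complex.I ^ (x j : ℕ) * ((-1) ^ (u j : ℕ) *
      (star (gate (x j) (u j) (z j)) * gate (x j) (u j) (z' j))) =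
      ∏ j, ∑ u : Fin 2, Complex.I ^ (x j : ℕ) * ((-1) ^ (u : ℕ) *
      (star (gate (x j) u (z j)) * gate (x j) u (z' j))) := fun x =>
    sum_bits_prod fun j a => Complex.I ^ (x j : ℕ) * ((-1) ^ (a : ℕ) *
      (star (gate (x j) a (z j)) * gate (x j) a (z' j)))
  simp only [h']
  rw [sum_bits_prod (fun j a => ∑ u : Fin 2, Complex.I ^ (a : ℕ) * ((-1) ^ (u : ℕ) *
      (star (gate a u (z j)) * gate a u (z' j))))]
  simp only [sum_gate_phase, pow_wt_eq_prod, Finset.prod_mul_distrib]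

/-- Contraction of the first tensor factor of `Ψ` with `c`. -/
noncomputable def contract {ι κ : Type} [Fintype ι] (c : ι → ℂ) (Ψ : ι × κ → ℂ) : κ → ℂ :=
  fun b => ∑ z, c z * Ψ (z, b)

/-- Averaging the honest parity observables with phases `Iʷᵗ⁽ˣ⁾` yields a rank-one operator on the
honest space. -/
theorem sum_phase_expectation {κ : Type} [Fintype κ] [DecidableEq κ] (Ψ : Bits ι × κ → ℂ)
    (B : Matrix κ κ ℂ) :
    ∑ x : Bits ι, Complex.I ^ wt x * ∑ u : Bits ι, (-1) ^ wt u *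
      (star (fun b => (gates x ⊗ₖ (1 : Matrix κ κ ℂ)).mulVec Ψ (u, b)) ⬝ᵥ
        B.mulVec (fun b => (gates x ⊗ₖ (1 : Matrix κ κ ℂ)).mulVec Ψ (u, b))) =
    star (contract (fun z => (-Complex.I) ^ wt z) Ψ) ⬝ᵥ
      B.mulVec (contract (fun z => Complex.I ^ wt z) Ψ) := by
  have hR : ∀ x u : Bits ι, (fun b => (gates x ⊗ₖ (1 : Matrix κ κ ℂ)).mulVec Ψ (u, b)) =
      ∑ z, gates x u z • fun b => Ψ (z, b) := by
    intro x u
    ext b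
    simp [Matrix.mulVec, dotProduct, Fintype.sum_prod_type, Matrix.kroneckerMap_apply,
      Matrix.one_apply, Finset.sum_apply]
  have hc : ∀ c : Bits ι → ℂ, contract c Ψ = ∑ z, c z • fun b => Ψ (z, b) := by
    intro c
    ext b
    simp [contract, Finset.sum_apply]
  have key : ∀ c c' : Bits ι → ℂ, star (∑ z, c z • fun b => Ψ (z, b)) ⬝ᵥ
      B.mulVec (∑ z, c' z • fun b => Ψ (z, b)) = ∑ z, ∑ z', (star (c z) * c' z') *
        (star (fun b => Ψ (z, b)) ⬝ᵥ B.mulVec (fun b => Ψ (z', b))) := by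
    intro c c'
    simp only [star_sum, star_smul, Matrix.mulVec_sum, Matrix.mulVec_smul, sum_dotProduct,
      dotProduct_sum, smul_dotProduct, dotProduct_smul, smul_eq_mul, Finset.mul_sum]
    rw [Finset.sum_comm]
    exact Finset.sum_congr rfl fun z _ => Finset.sum_congr rfl fun z' _ => by ring
  simp only [hR, hc, key, Finset.mul_sum]
  have hsw : ∀ f : Bits ι → Bits ι → Bits ι → Bits ι → ℂ,
      ∑ x, ∑ u, ∑ z, ∑ z', f x u z z' = ∑ z, ∑ z', ∑ x, ∑ u, f x u z z' := by
    intro f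
    calc ∑ x, ∑ u, ∑ z, ∑ z', f x u z z' = ∑ x, ∑ z, ∑ u, ∑ z', f x u z z' :=
          Finset.sum_congr rfl fun x _ => Finset.sum_comm
      _ = ∑ z, ∑ x, ∑ u, ∑ z', f x u z z' := Finset.sum_comm
      _ = ∑ z, ∑ x, ∑ z', ∑ u, f x u z z' :=
          Finset.sum_congr rfl fun z _ => Finset.sum_congr rfl fun x _ => Finset.sum_comm
      _ = _ := Finset.sum_congr rfl fun z _ => Finset.sum_comm
  rw [hsw]
  refine Finset.sum_congr rfl fun z _ => Finset.sum_congr rfl fun z' _ => ?_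
  have h1 : star ((-Complex.I) ^ wt z) = Complex.I ^ wt z := by simp
  rw [h1, ← sum_gates_phase z z', Finset.sum_mul]
  refine Finset.sum_congr rfl fun x _ => ?_
  rw [Finset.sum_mul]
  exact Finset.sum_congr rfl fun u _ => by ring

end Phases

/-! ## Hermitian contractions -/

section Contraction

variable {κ : Type} [Fintype κ] [DecidableEq κ]

theorem re_dotProduct_mulVec_sq_le {B : Matrix κ κ ℂ} (h1 : (1 - B).PosSemidef)
    (h2 : (1 + B).PosSemidef) (x y : κ → ℂ) :
    (star x ⬝ᵥ B.mulVec y).re ^ 2 ≤ (star x ⬝ᵥ x).re * (star y ⬝ᵥ y).re := by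
  have hB : B.IsHermitian := by
    have := h1.1.sub (Matrix.isHermitian_one (n := κ) (α := ℂ))
    simpa using this.neg
  have hsymm : (star y ⬝ᵥ B.mulVec x).re = (star x ⬝ᵥ B.mulVec y).re := by
    have : star y ⬝ᵥ B.mulVec x = star (star x ⬝ᵥ B.mulVec y) := by
      rw [Matrix.star_dotProduct, Matrix.star_mulVec, hB.eq, ← Matrix.dotProduct_mulVec]
    rw [this]; simp
  have hxy : (star y ⬝ᵥ x).re = (star x ⬝ᵥ y).re := by
    rw [Matrix.star_dotProduct]; simp
  have hs : ∀ s : ℝ, 0 ≤ (star x ⬝ᵥ x).re * (s * s) + (-2 * (star x ⬝ᵥ B.mulVec y).re) * s +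
      (star y ⬝ᵥ y).re := by
    intro s
    have e1 := h1.re_dotProduct_nonneg ((s : ℂ) • x + y)
    have e2 := h2.re_dotProduct_nonneg ((s : ℂ) • x - y)
    simp only [Matrix.sub_mulVec, Matrix.add_mulVec, Matrix.one_mulVec, star_add, star_sub,
      star_smul, Matrix.mulVec_add, Matrix.mulVec_sub, Matrix.mulVec_smul, add_dotProduct,
      sub_dotProduct, dotProduct_add, dotProduct_sub, smul_dotProduct, dotProduct_smul,
      smul_eq_mul, RCLike.star_def, Complex.conj_ofReal, RCLike.re_eq_complex_re, Complex.add_re,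
      Complex.sub_re, Complex.re_ofReal_mul] at e1 e2
    rw [hsymm, hxy] at e1 e2
    linarith
  have := discrim_le_zero hs
  rw [discrim] at this
  nlinarith

theorem four_mul_re_sq_le {B : Matrix κ κ ℂ} (h1 : (1 - B).PosSemidef)
    (h2 : (1 + B).PosSemidef) (m p : κ → ℂ) :
    4 * (star m ⬝ᵥ B.mulVec p).re ^ 2 ≤
      ((star p ⬝ᵥ p).re + (star m ⬝ᵥ m).re) ^ 2 - 4 * (star m ⬝ᵥ p).im ^ 2 := by
  have hB : B.IsHermitian := by
    have := h1.1.sub (Matrix.isHermitian_one (n := κ) (α := ℂ))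
    simpa using this.neg
  have hsymm : star p ⬝ᵥ B.mulVec m = star (star m ⬝ᵥ B.mulVec p) := by
    rw [Matrix.star_dotProduct, Matrix.star_mulVec, hB.eq, ← Matrix.dotProduct_mulVec]
  have hxy : star p ⬝ᵥ m = star (star m ⬝ᵥ p) := by
    rw [Matrix.star_dotProduct]
  have hp : (star p ⬝ᵥ B.mulVec p).im = 0 := hB.im_star_dotProduct_mulVec_self p
  have hm : (star m ⬝ᵥ B.mulVec m).im = 0 := hB.im_star_dotProduct_mulVec_self m
  have h := re_dotProduct_mulVec_sq_le h1 h2 (m + Complex.I • p) (p + Complex.I • m)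
  simp only [star_add, star_smul, Matrix.mulVec_add, Matrix.mulVec_smul, add_dotProduct,
    dotProduct_add, smul_dotProduct, dotProduct_smul, smul_eq_mul, hsymm, hxy] at h
  simp [hp, hm] at h
  nlinarith

/-- A Hermitian contraction `B` satisfies `(Re ⟨m|B|p⟩)² ≤ ‖p‖² ‖m‖² - (Im ⟨m|p⟩)²`. -/
theorem re_sq_le_sub_im_sq {B : Matrix κ κ ℂ} (h1 : (1 - B).PosSemidef)
    (h2 : (1 + B).PosSemidef) (m p : κ → ℂ) :
    (star m ⬝ᵥ B.mulVec p).re ^ 2 ≤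
      (star p ⬝ᵥ p).re * (star m ⬝ᵥ m).re - (star m ⬝ᵥ p).im ^ 2 := by
  have hA := (Complex.nonneg_iff.mp (dotProduct_star_self_nonneg p)).1
  have hC := (Complex.nonneg_iff.mp (dotProduct_star_self_nonneg m)).1
  have h := four_mul_re_sq_le h1 h2 ((√(star p ⬝ᵥ p).re : ℂ) • m) ((√(star m ⬝ᵥ m).re : ℂ) • p)
  simp only [star_smul, Matrix.mulVec_smul, smul_dotProduct, dotProduct_smul, smul_eq_mul,
    RCLike.star_def, Complex.conj_ofReal, Complex.re_ofReal_mul, Complex.im_ofReal_mul] at h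
  have sA := Real.sq_sqrt hA
  have sC := Real.sq_sqrt hC
  rcases eq_or_lt_of_le hA with h0 | h0
  · have : p = 0 := by
      rw [← dotProduct_star_self_eq_zero]
      exact Complex.ext h0.symm (Complex.nonneg_iff.mp (dotProduct_star_self_nonneg p)).2.symm
    simp [this]
  rcases eq_or_lt_of_le hC with h0' | h0'
  · have : m = 0 := by
      rw [← dotProduct_star_self_eq_zero]
      exact Complex.ext h0'.symm (Complex.nonneg_iff.mp (dotProduct_star_self_nonneg m)).2.symm
    simp [this]
  set a := √(star p ⬝ᵥ p).re
  set c := √(star m ⬝ᵥ m).re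
  rw [← sA, ← sC] at h ⊢
  have ha : 0 < a := Real.sqrt_pos.mpr h0
  have hc : 0 < c := Real.sqrt_pos.mpr h0'
  refine le_of_mul_le_mul_left ?_ (show 0 < 4 * (a ^ 2 * c ^ 2) by positivity)
  nlinarith

theorem im_sq_le_sub_re_sq {B : Matrix κ κ ℂ} (h1 : (1 - B).PosSemidef)
    (h2 : (1 + B).PosSemidef) (m p : κ → ℂ) :
    (star m ⬝ᵥ B.mulVec p).im ^ 2 ≤
      (star p ⬝ᵥ p).re * (star m ⬝ᵥ m).re - (star m ⬝ᵥ p).re ^ 2 := by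
  have h := re_sq_le_sub_im_sq h1 h2 m (Complex.I • p)
  simp only [star_smul, Matrix.mulVec_smul, smul_dotProduct, dotProduct_smul, smul_eq_mul] at h
  simpa [← mul_assoc] using h

end Contraction

/-! ## Trace distance of pure states -/

section TraceDistance

variable {ι : Type} [Fintype ι]

theorem rank_ketbra_sub_ketbra_le (ψ φ : ι → ℂ) : (ketbra ψ - ketbra φ).rank ≤ 2 := by
  have h : ketbra ψ - ketbra φ = Matrix.of (fun i (j : Fin 2) => if j = 0 then ψ i else φ i) *
      Matrix.of (fun (j : Fin 2) i => if j = 0 then star (ψ i) else -star (φ i)) := by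
    ext a b
    simp [ketbra, Matrix.vecMulVec_apply, Matrix.mul_apply, Fin.sum_univ_two, sub_eq_add_neg]
  rw [h]
  exact (Matrix.rank_mul_le_left _ _).trans ((Matrix.rank_le_card_width _).trans (by simp))

theorem trace_ketbra_mul_ketbra (ψ φ : ι → ℂ) :
    (ketbra ψ * ketbra φ).trace = (star ψ ⬝ᵥ φ) * (star φ ⬝ᵥ ψ) := by
  simp only [ketbra, Matrix.vecMulVec_mul_vecMulVec, Matrix.trace_vecMulVec, dotProduct_smul,
    smul_eq_mul]
  rw [dotProduct_comm ψ (star φ)]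

variable [DecidableEq ι]

theorem sum_eigenvalues_sq {M : Matrix ι ι ℂ} (hM : M.IsHermitian) :
    ((∑ i, hM.eigenvalues i ^ 2 : ℝ) : ℂ) = (M * M).trace := by
  conv_rhs => rw [hM.spectral_theorem, ← map_mul, Unitary.conjStarAlgAut_apply,
    Matrix.trace_mul_cycle]
  simp [Matrix.trace, pow_two]

theorem pureDist_nonneg (ψ φ : ι → ℂ) : 0 ≤ pureDist ψ φ :=
  mul_nonneg (by norm_num) (Finset.sum_nonneg fun _ _ => abs_nonneg _)

theorem pureDist_sq_le {ψ φ : ι → ℂ} (hψ : star ψ ⬝ᵥ ψ = 1) (hφ : star φ ⬝ᵥ φ = 1) :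
    pureDist ψ φ ^ 2 ≤ 1 - ‖star φ ⬝ᵥ ψ‖ ^ 2 := by
  set hM := (ketbra_isHermitian ψ).sub (ketbra_isHermitian φ)
  have h2 : ∑ i, hM.eigenvalues i ^ 2 = 2 - 2 * ‖star φ ⬝ᵥ ψ‖ ^ 2 := by
    have h := sum_eigenvalues_sq hM
    rw [mul_sub, sub_mul, sub_mul, Matrix.trace_sub, Matrix.trace_sub, Matrix.trace_sub,
      trace_ketbra_mul_ketbra, trace_ketbra_mul_ketbra, trace_ketbra_mul_ketbra,
      trace_ketbra_mul_ketbra, hψ, hφ, Matrix.star_dotProduct ψ φ] at h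
    have h3 : star φ ⬝ᵥ ψ * star (star φ ⬝ᵥ ψ) = ((‖star φ ⬝ᵥ ψ‖ ^ 2 : ℝ) : ℂ) := by
      rw [RCLike.star_def, Complex.mul_conj, Complex.normSq_eq_norm_sq]
    rw [mul_comm (star (star φ ⬝ᵥ ψ)), h3] at h
    have := congrArg Complex.re h
    simp only [Complex.ofReal_re, Complex.sub_re, mul_one, Complex.one_re] at this
    rw [this]
    ring
  have h3 : (∑ i, |hM.eigenvalues i|) ^ 2 ≤ 2 * ∑ i, hM.eigenvalues i ^ 2 := by
    have hs : ∀ f : ι → ℝ, (∀ i, hM.eigenvalues i = 0 → f i = 0) →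
        ∑ i ∈ Finset.univ.filter (fun i => hM.eigenvalues i ≠ 0), f i = ∑ i, f i := by
      intro f hf
      refine Finset.sum_subset (Finset.subset_univ _) fun i _ hi => hf i ?_
      simpa using hi
    rw [← hs (fun i => |hM.eigenvalues i|) (by simp +contextual),
      ← hs (fun i => hM.eigenvalues i ^ 2) (by simp +contextual)]
    refine sq_sum_le_card_mul_sum_sq.trans ?_
    simp only [sq_abs]
    gcongr
    rw [← Fintype.card_subtype, ← hM.rank_eq_card_non_zero_eigs]
    exact_mod_cast rank_ketbra_sub_ketbra_le ψ φ
  have h4 : pureDist ψ φ = (1 / 2) * ∑ i, |hM.eigenvalues i| := rfl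
  rw [h4, mul_pow]
  linarith

end TraceDistance

/-! ## Unitaries with prescribed action -/

section Unitaries

variable {κ : Type} [Fintype κ]

theorem dotProduct_eq_inner (x y : κ → ℂ) :
    star x ⬝ᵥ y = inner ℂ (WithLp.toLp 2 x) (WithLp.toLp 2 y) := by
  rw [EuclideanSpace.inner_toLp_toLp, dotProduct_comm]

theorem dotProduct_self_re (x : κ → ℂ) : (star x ⬝ᵥ x).re = ‖WithLp.toLp 2 x‖ ^ 2 := by
  rw [dotProduct_eq_inner, inner_self_eq_norm_sq_to_K]
  norm_cast

theorem exists_orthonormalBasis_of_orthogonal (v : κ → EuclideanSpace ℂ κ)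
    (hv : Pairwise fun i j => inner ℂ (v i) (v j) = 0) :
    ∃ b : OrthonormalBasis κ ℂ (EuclideanSpace ℂ κ), ∀ i, v i = (‖v i‖ : ℂ) • b i := by
  have ho : Orthonormal ℂ (({i | v i ≠ 0} : Set κ).domRestrict
      fun i => ((‖v i‖ : ℂ)⁻¹) • v i) := by
    refine ⟨fun i => ?_, fun i j hij => ?_⟩
    · have : ‖v i‖ ≠ 0 := norm_ne_zero_iff.mpr i.2
      simp [Set.domRestrict, norm_smul, this]
    · have := hv (fun h => hij (Subtype.ext h))
      simp [Set.domRestrict, inner_smul_left, inner_smul_right, this]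
  obtain ⟨b, hb⟩ := ho.exists_orthonormalBasis_extension_of_card_eq (by simp)
  refine ⟨b, fun i => ?_⟩
  by_cases hi : v i = 0
  · simp [hi]
  · have : (‖v i‖ : ℂ) ≠ 0 := by simpa using hi
    rw [hb i hi, smul_smul, mul_inv_cancel₀ this, one_smul]

variable [DecidableEq κ]

theorem exists_unitary_mulVec_basis (b b' : OrthonormalBasis κ ℂ (EuclideanSpace ℂ κ)) :
    ∃ U : Matrix.unitaryGroup κ ℂ, ∀ i,
      (U : Matrix κ κ ℂ).mulVec (b i).ofLp = (b' i).ofLp := by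
  refine ⟨⟨_, (b.equiv b' (Equiv.refl κ)).toMatrix_mem_unitaryGroup
    (EuclideanSpace.basisFun κ ℂ) (EuclideanSpace.basisFun κ ℂ)⟩, fun i => ?_⟩
  have h := LinearMap.toMatrix_mulVec_repr (EuclideanSpace.basisFun κ ℂ).toBasis
    (EuclideanSpace.basisFun κ ℂ).toBasis
    ((b.equiv b' (Equiv.refl κ)).toLinearEquiv : EuclideanSpace ℂ κ →ₗ[ℂ] _) (b i)
  have hr : ∀ x : EuclideanSpace ℂ κ,
      ⇑((EuclideanSpace.basisFun κ ℂ).toBasis.repr x) = x.ofLp := by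
    intro x; ext j; simp
  rw [hr, hr] at h
  rw [h]
  simp

theorem exists_unitary_norm_dotProduct (p g : κ → ℂ) (hg : star g ⬝ᵥ g = 1) [Nonempty κ] :
    ∃ U : Matrix.unitaryGroup κ ℂ,
      ‖star g ⬝ᵥ (U : Matrix κ κ ℂ).mulVec p‖ ^ 2 = (star p ⬝ᵥ p).re := by
  obtain ⟨i⟩ := ‹Nonempty κ›
  have hgn : ‖WithLp.toLp 2 g‖ = 1 := by
    have := dotProduct_self_re g
    rw [hg, Complex.one_re] at this
    nlinarith [norm_nonneg (WithLp.toLp 2 g)]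
  have hpw : ∀ x : EuclideanSpace ℂ κ,
      Pairwise fun j l => inner ℂ ((Pi.single i x : κ → EuclideanSpace ℂ κ) j)
        ((Pi.single i x : κ → EuclideanSpace ℂ κ) l) = 0 := by
    intro x j l hjl
    by_cases hj : j = i
    · subst hj
      simp [Pi.single_eq_of_ne hjl.symm]
    · simp [Pi.single_eq_of_ne hj]
  obtain ⟨b, hb⟩ := exists_orthonormalBasis_of_orthogonal _ (hpw (WithLp.toLp 2 p))
  obtain ⟨b', hb'⟩ := exists_orthonormalBasis_of_orthogonal _ (hpw (WithLp.toLp 2 g))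
  obtain ⟨U, hU⟩ := exists_unitary_mulVec_basis b b'
  refine ⟨U, ?_⟩
  have h1 := hb i
  have h2 := hb' i
  simp only [Pi.single_eq_same, hgn, Complex.ofReal_one, one_smul] at h1 h2
  have h3 : p = (‖WithLp.toLp 2 p‖ : ℂ) • (b i).ofLp := congrArg WithLp.ofLp h1
  have h4 : g = (b' i).ofLp := congrArg WithLp.ofLp h2
  have h5 : (U : Matrix κ κ ℂ).mulVec p = (‖WithLp.toLp 2 p‖ : ℂ) • g := by
    conv_lhs => rw [h3]
    rw [Matrix.mulVec_smul, hU, ← h4]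
  rw [h5, dotProduct_smul, hg, dotProduct_self_re]
  simp

/-- The squared overlap of two vectors with an orthonormal pair can be raised by a unitary to
`‖p‖₂² + ‖m‖₂² + 2 √(det G)`, where `G` is the Gram matrix of `p` and `m`. -/
theorem exists_unitary_overlap [Nontrivial κ] (p m g h : κ → ℂ) (hg : star g ⬝ᵥ g = 1)
    (hh : star h ⬝ᵥ h = 1) (hgh : star g ⬝ᵥ h = 0) :
    ∃ U : Matrix.unitaryGroup κ ℂ,
      (star p ⬝ᵥ p).re + (star m ⬝ᵥ m).re +
        2 * √((star p ⬝ᵥ p).re * (star m ⬝ᵥ m).re - ‖star m ⬝ᵥ p‖ ^ 2) ≤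
      ‖star g ⬝ᵥ (U : Matrix κ κ ℂ).mulVec p + star h ⬝ᵥ (U : Matrix κ κ ℂ).mulVec m‖ ^ 2 := by
  obtain ⟨i, j, hij⟩ := exists_pair_ne κ
  have hpw : ∀ x y : EuclideanSpace ℂ κ, inner ℂ x y = 0 →
      Pairwise fun k l => inner ℂ ((Pi.single i x + Pi.single j y : κ → EuclideanSpace ℂ κ) k)
        ((Pi.single i x + Pi.single j y : κ → EuclideanSpace ℂ κ) l) = 0 := by
    intro x y hxy k l hkl
    have hyx : inner ℂ y x = 0 := inner_eq_zero_symm.mp hxy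
    simp only [Pi.add_apply, Pi.single_apply]
    split_ifs <;> simp_all
  have hbasis : ∀ x y : EuclideanSpace ℂ κ, inner ℂ x y = 0 →
      ∃ b : OrthonormalBasis κ ℂ (EuclideanSpace ℂ κ), x = (‖x‖ : ℂ) • b i ∧
        y = (‖y‖ : ℂ) • b j := by
    intro x y hxy
    obtain ⟨b, hb⟩ := exists_orthonormalBasis_of_orthogonal _ (hpw x y hxy)
    refine ⟨b, ?_, ?_⟩
    · simpa [hij] using hb i
    · simpa [hij.symm] using hb j
  set P : EuclideanSpace ℂ κ := WithLp.toLp 2 p with hP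
  set M : EuclideanSpace ℂ κ := WithLp.toLp 2 m with hM
  set z' : ℂ := inner ℂ P M / (‖P‖ ^ 2 : ℝ) with hz'
  have horth : inner ℂ P (M - z' • P) = 0 := by
    rw [inner_sub_right, inner_smul_right, inner_self_eq_norm_sq_to_K]
    by_cases h0 : ‖P‖ = 0
    · have : P = 0 := norm_eq_zero.mp h0
      simp [this]
    · have : (‖P‖ : ℂ) ≠ 0 := by exact_mod_cast h0
      rw [hz']
      push_cast
      simp only [RCLike.ofReal, Complex.coe_algebraMap]
      field_simp
      simp
  obtain ⟨b, hb1, hb2⟩ := hbasis P (M - z' • P) horth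
  set a : ℝ := ‖P‖ with ha
  set w : ℝ := ‖M - z' • P‖ with hw
  set z : ℂ := z' * a with hz
  have hMz : M = z • b i + (w : ℂ) • b j := by
    rw [← hb2, hz, mul_smul, ← hb1]
    abel
  clear_value z
  have ha0 : 0 ≤ a := norm_nonneg _
  have hw0 : 0 ≤ w := norm_nonneg _
  have hbi : inner ℂ (b i) (b i) = (1 : ℂ) := by simp [inner_self_eq_norm_sq_to_K]
  have hbj : inner ℂ (b j) (b j) = (1 : ℂ) := by simp [inner_self_eq_norm_sq_to_K]
  have hbij : inner ℂ (b i) (b j) = (0 : ℂ) := b.orthonormal.2 hij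
  have hbji : inner ℂ (b j) (b i) = (0 : ℂ) := b.orthonormal.2 hij.symm
  have hA : (star p ⬝ᵥ p).re = a ^ 2 := dotProduct_self_re p
  have hγ : star m ⬝ᵥ p = star z * a := by
    rw [dotProduct_eq_inner, ← hP, ← hM, hMz, hb1]
    simp only [inner_add_left, inner_smul_left, inner_smul_right, hbi, hbji, RCLike.star_def]
    ring
  have hC : (star m ⬝ᵥ m).re = ‖z‖ ^ 2 + w ^ 2 := by
    rw [dotProduct_eq_inner, ← hM, hMz]
    simp only [inner_add_left, inner_add_right, inner_smul_left, inner_smul_right, hbi, hbj, hbij,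
      hbji, Complex.conj_ofReal, mul_one, mul_zero, add_zero, zero_add]
    rw [Complex.mul_conj', ← Complex.ofReal_mul, ← Complex.ofReal_pow, ← Complex.ofReal_add,
      Complex.ofReal_re]
    ring
  have hN : (star p ⬝ᵥ p).re + (star m ⬝ᵥ m).re +
      2 * √((star p ⬝ᵥ p).re * (star m ⬝ᵥ m).re - ‖star m ⬝ᵥ p‖ ^ 2) = (a + w) ^ 2 + ‖z‖ ^ 2 := by
    rw [hA, hC, hγ]
    have : a ^ 2 * (‖z‖ ^ 2 + w ^ 2) - ‖star z * (a : ℂ)‖ ^ 2 = (a * w) ^ 2 := by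
      rw [norm_mul, norm_star, Complex.norm_real, mul_pow, Real.norm_eq_abs, sq_abs]
      ring
    rw [this, Real.sqrt_sq (mul_nonneg ha0 hw0)]
    ring
  rw [hN]
  set N : ℝ := (a + w) ^ 2 + ‖z‖ ^ 2 with hNdef
  rcases eq_or_lt_of_le (show 0 ≤ N by positivity) with h0 | h0
  · exact ⟨1, by rw [← h0]; positivity⟩
  have hsN : (√N : ℂ) ≠ 0 := by
    exact_mod_cast (Real.sqrt_pos.mpr h0).ne'
  have hsN2 : (√N : ℂ) * (√N : ℂ) = N := by
    exact_mod_cast Real.mul_self_sqrt h0.le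
  have hNc : (N : ℂ) = ((a : ℂ) + w) ^ 2 + star z * z := by
    rw [hNdef, RCLike.star_def, Complex.conj_mul']
    push_cast
    ring
  set G : EuclideanSpace ℂ κ := WithLp.toLp 2 g with hG
  set K : EuclideanSpace ℂ κ := WithLp.toLp 2 h with hK
  have hGG : inner ℂ G G = (1 : ℂ) := by rw [← hg, dotProduct_eq_inner]
  have hKK : inner ℂ K K = (1 : ℂ) := by rw [← hh, dotProduct_eq_inner]
  have hGK : inner ℂ G K = (0 : ℂ) := by rw [← hgh, dotProduct_eq_inner]
  have hKG : inner ℂ K G = (0 : ℂ) := inner_eq_zero_symm.mp hGK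
  set X : EuclideanSpace ℂ κ := (√N : ℂ)⁻¹ • (((a : ℂ) + w) • G + star z • K) with hX
  set Y : EuclideanSpace ℂ κ := (√N : ℂ)⁻¹ • (((a : ℂ) + w) • K - z • G) with hY
  have hXY : inner ℂ X Y = (0 : ℂ) := by
    simp only [hX, hY, inner_add_left, inner_sub_right, inner_smul_left, inner_smul_right, hGG,
      hKK, hGK, hKG, RCLike.star_def, Complex.conj_conj, map_add, Complex.conj_ofReal]
    ring
  have hXX : inner ℂ X X = (1 : ℂ) := by
    simp only [hX, inner_add_left, inner_add_right, inner_smul_left, inner_smul_right, hGG, hKK,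
      hGK, hKG, map_inv₀, Complex.conj_ofReal, map_add, RCLike.star_def, Complex.conj_conj]
    rw [RCLike.star_def] at hNc
    field_simp
    rw [pow_two, hsN2, hNc]
    ring
  have hYY : inner ℂ Y Y = (1 : ℂ) := by
    simp only [hY, inner_sub_left, inner_sub_right, inner_smul_left, inner_smul_right, hGG, hKK,
      hGK, hKG, map_inv₀, Complex.conj_ofReal, map_add]
    rw [RCLike.star_def] at hNc
    field_simp
    rw [pow_two, hsN2, hNc]
    ring
  have hnX : ‖X‖ = 1 := by
    rw [inner_self_eq_norm_sq_to_K] at hXX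
    exact (pow_eq_one_iff_of_nonneg (norm_nonneg _) two_ne_zero).mp
      (Complex.ofReal_injective (by simpa using hXX))
  have hnY : ‖Y‖ = 1 := by
    rw [inner_self_eq_norm_sq_to_K] at hYY
    exact (pow_eq_one_iff_of_nonneg (norm_nonneg _) two_ne_zero).mp
      (Complex.ofReal_injective (by simpa using hYY))
  obtain ⟨b', hX', hY'⟩ := hbasis X Y hXY
  rw [hnX, Complex.ofReal_one, one_smul] at hX'
  rw [hnY, Complex.ofReal_one, one_smul] at hY'
  obtain ⟨U, hU⟩ := exists_unitary_mulVec_basis b b'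
  refine ⟨U, ?_⟩
  have hUp : WithLp.toLp 2 ((U : Matrix κ κ ℂ).mulVec p) = (a : ℂ) • X := by
    have : p = (a : ℂ) • (b i).ofLp := congrArg WithLp.ofLp hb1
    rw [this, Matrix.mulVec_smul, hU, ← hX']
    rfl
  have hUm : WithLp.toLp 2 ((U : Matrix κ κ ℂ).mulVec m) = z • X + (w : ℂ) • Y := by
    have : m = z • (b i).ofLp + (w : ℂ) • (b j).ofLp := congrArg WithLp.ofLp hMz
    rw [this, Matrix.mulVec_add, Matrix.mulVec_smul, Matrix.mulVec_smul, hU, hU, ← hX', ← hY']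
    rfl
  have hval : star g ⬝ᵥ (U : Matrix κ κ ℂ).mulVec p + star h ⬝ᵥ (U : Matrix κ κ ℂ).mulVec m =
      (√N : ℂ) := by
    rw [dotProduct_eq_inner, dotProduct_eq_inner, hUp, hUm, ← hG, ← hK, hX, hY]
    simp only [inner_add_right, inner_sub_right, inner_smul_right, hGG, hKK, hGK, hKG]
    field_simp
    rw [pow_two, hsN2, hNc]
    ring
  rw [hval, Complex.norm_real, Real.norm_eq_abs, sq_abs, Real.sq_sqrt h0.le]

end Unitaries

/-! ## The GHZ state in terms of phases -/

section Target

theorem I_pow_add_neg_I_pow (w : ℕ) : Complex.I ^ w + (-Complex.I) ^ w =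
    if w % 4 = 0 then 2 else if w % 4 = 2 then -2 else 0 := by
  have h4 : (-Complex.I) ^ 4 = 1 := by rw [neg_pow, Complex.I_pow_four]; norm_num
  have h : w = 4 * (w / 4) + w % 4 := (Nat.div_add_mod w 4).symm
  have e : Complex.I ^ w + (-Complex.I) ^ w = Complex.I ^ (w % 4) + (-Complex.I) ^ (w % 4) := by
    conv_lhs => rw [h]
    rw [pow_add, pow_add, pow_mul, pow_mul, h4, Complex.I_pow_four]
    simp
  rw [e]
  have : w % 4 < 4 := Nat.mod_lt _ (by norm_num)
  interval_cases w % 4 <;> simp [pow_succ] <;> norm_num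

theorem ghz_eq (n : ℕ) (y : Bits (Fin n)) : ghz n y =
    (((√((2 : ℝ) ^ (n - 1)))⁻¹ : ℝ) : ℂ) / 2 * (Complex.I ^ wt y + (-Complex.I) ^ wt y) := by
  rw [I_pow_add_neg_I_pow, ghz]
  split_ifs <;> ring_nf

variable {n : ℕ} (H : Finset (Fin n))

theorem wt_eq_add (x : Bits (Fin n)) :
    wt x = wt (honestPart H x) + wt (dishonestPart H x) := by
  simp only [wt, honestPart, dishonestPart]
  convert (Fintype.sum_subtype_add_sum_subtype (fun j => j ∈ H) fun j => (x j : ℕ)).symm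

theorem honestPart_join (u : Bits {j : Fin n // j ∈ H}) (v : Bits {j : Fin n // j ∉ H}) :
    honestPart H (join H u v) = u := by
  ext j
  simp [honestPart, join]

theorem dishonestPart_join (u : Bits {j : Fin n // j ∈ H}) (v : Bits {j : Fin n // j ∉ H}) :
    dishonestPart H (join H u v) = v := by
  ext j
  simp [dishonestPart, join, j.2]

theorem wt_join (u : Bits {j : Fin n // j ∈ H}) (v : Bits {j : Fin n // j ∉ H}) :
    wt (join H u v) = wt u + wt v := by
  rw [wt_eq_add H, honestPart_join, dishonestPart_join]

theorem join_honestPart_dishonestPart (y : Bits (Fin n)) :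
    join H (honestPart H y) (dishonestPart H y) = y := by
  ext j
  simp [honestPart, dishonestPart, join]

theorem sum_honestPart_dishonestPart {M : Type} [AddCommMonoid M]
    (f : Bits {j : Fin n // j ∈ H} → Bits {j : Fin n // j ∉ H} → M) :
    ∑ y : Bits (Fin n), f (honestPart H y) (dishonestPart H y) = ∑ u, ∑ v, f u v := by
  rw [← Fintype.sum_prod_type' (f := f)]
  exact (Equiv.piEquivPiSubtypeProd (fun j => j ∈ H) (fun _ => Fin 2)).sum_comp
    (fun p => f p.1 p.2)

/-- The vector `∑ᵥ cʷᵗ⁽ᵛ⁾ |v⟩ ⊗ |0⟩` of the dishonest space. -/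
noncomputable def dishonestPhase (d : ℕ) (c : ℂ) : DishonestIdx H d → ℂ :=
  fun b => if b.2 = 0 then c ^ wt b.1 else 0

theorem target_eq (d : ℕ) (p : HonestIdx H × DishonestIdx H d) : target H d p =
    (((√((2 : ℝ) ^ (n - 1)))⁻¹ : ℝ) : ℂ) / 2 * (Complex.I ^ wt p.1 *
      dishonestPhase H d Complex.I p.2 + (-Complex.I) ^ wt p.1 *
      dishonestPhase H d (-Complex.I) p.2) := by
  rw [target, dishonestPhase, dishonestPhase]
  split_ifs
  · rw [ghz_eq, wt_join, pow_add, pow_add]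
  · simp

theorem dotProduct_dishonestPhase (d : ℕ) (c c' : ℂ) :
    star (dishonestPhase H d c) ⬝ᵥ dishonestPhase H d c' =
      ∑ v : Bits {j : Fin n // j ∉ H}, (star c * c') ^ wt v := by
  simp [dotProduct, dishonestPhase, Fintype.sum_prod_type, mul_pow, apply_ite]

theorem dotProduct_dishonestPhase_self (d : ℕ) {c : ℂ} (hc : star c * c = 1) :
    star (dishonestPhase H d c) ⬝ᵥ dishonestPhase H d c = 2 ^ (n - H.card) := by
  rw [dotProduct_dishonestPhase, hc]
  simp [Fintype.card_subtype_compl]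

theorem dotProduct_dishonestPhase_of_eq_neg_one [Nonempty {j : Fin n // j ∉ H}] (d : ℕ) {c c' : ℂ}
    (hc : star c * c' = -1) :
    star (dishonestPhase H d c) ⬝ᵥ dishonestPhase H d c' = 0 := by
  rw [dotProduct_dishonestPhase, hc, sum_neg_one_pow_wt]

theorem contract_one_kronecker_mulVec {ι κ : Type} [Fintype ι] [DecidableEq ι] [Fintype κ]
    (c : ι → ℂ) (U : Matrix κ κ ℂ) (Ψ : ι × κ → ℂ) :
    contract c (((1 : Matrix ι ι ℂ) ⊗ₖ U).mulVec Ψ) = U.mulVec (contract c Ψ) := by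
  ext b
  simp only [contract, Matrix.mulVec, dotProduct, Fintype.sum_prod_type,
    Matrix.kroneckerMap_apply, Matrix.one_apply, ite_mul, one_mul, zero_mul, Finset.sum_ite_irrel,
    Finset.sum_const_zero, Finset.sum_ite_eq, Finset.mem_univ, if_true, Finset.mul_sum]
  rw [Finset.sum_comm]
  exact Finset.sum_congr rfl fun _ _ => Finset.sum_congr rfl fun _ _ => by ring

theorem star_target_dotProduct (d : ℕ) (Ψ : HonestIdx H × DishonestIdx H d → ℂ) :
    star (target H d) ⬝ᵥ Ψ = (((√((2 : ℝ) ^ (n - 1)))⁻¹ : ℝ) : ℂ) / 2 *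
      (star (dishonestPhase H d Complex.I) ⬝ᵥ contract (fun z => (-Complex.I) ^ wt z) Ψ +
        star (dishonestPhase H d (-Complex.I)) ⬝ᵥ contract (fun z => Complex.I ^ wt z) Ψ) := by
  simp only [dotProduct, Pi.star_apply, target_eq, contract, Finset.mul_sum,
    ← Finset.sum_add_distrib, Fintype.sum_prod_type_right]
  refine Finset.sum_congr rfl fun b _ => Finset.sum_congr rfl fun v _ =>
    Finset.sum_congr rfl fun u _ => ?_
  simp only [star_mul', star_add, star_pow, star_neg, RCLike.star_def, Complex.conj_I,
    Complex.conj_ofReal, star_div₀, neg_neg, map_ofNat]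
  ring

theorem sum_target_sq [NeZero n] (d : ℕ) :
    star (target H d) ⬝ᵥ target H d = 1 := by
  have h1 : star (target H d) ⬝ᵥ target H d = ∑ y, star (ghz n y) * ghz n y := by
    have h := sum_honestPart_dishonestPart H fun u v => star (ghz n (join H u v)) *
      ghz n (join H u v)
    simp only [join_honestPart_dishonestPart] at h
    rw [h]
    simp [dotProduct, target, Fintype.sum_prod_type, apply_ite]
  have h2 : ∀ y : Bits (Fin n), star (ghz n y) * ghz n y =
      (2 ^ (n - 1) : ℂ)⁻¹ * 2⁻¹ * (1 + (-1) ^ wt y) := by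
    intro y
    have hc : (((√((2 : ℝ) ^ (n - 1)))⁻¹ : ℝ) : ℂ) * (((√((2 : ℝ) ^ (n - 1)))⁻¹ : ℝ) : ℂ) =
        (2 ^ (n - 1) : ℂ)⁻¹ := by
      rw [← Complex.ofReal_mul, ← mul_inv, Real.mul_self_sqrt (by positivity)]
      push_cast
      rfl
    have hs : Complex.I ^ wt y * Complex.I ^ wt y = (-1) ^ wt y := by
      rw [← mul_pow, Complex.I_mul_I]
    have hs' : (-Complex.I) ^ wt y * (-Complex.I) ^ wt y = (-1) ^ wt y := by
      rw [← mul_pow]; simp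
    have hs'' : Complex.I ^ wt y * (-Complex.I) ^ wt y = 1 := by
      rw [← mul_pow]; simp
    rw [ghz_eq]
    simp only [star_mul', star_add, star_pow, star_neg, RCLike.star_def, Complex.conj_I,
      Complex.conj_ofReal, star_div₀, neg_neg, map_ofNat]
    rw [← hc]
    linear_combination (((√((2 : ℝ) ^ (n - 1)))⁻¹ : ℝ) : ℂ) *
      (((√((2 : ℝ) ^ (n - 1)))⁻¹ : ℝ) : ℂ) / 4 * (hs + hs' + 2 * hs'')
  simp only [h1, h2]
  rw [← Finset.mul_sum, Finset.sum_add_distrib, sum_neg_one_pow_wt]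
  have hn : n = n - 1 + 1 := (Nat.succ_pred_eq_of_ne_zero (NeZero.ne n)).symm
  have : (2 : ℂ) ^ n = 2 ^ (n - 1) * 2 := by rw [← pow_succ, ← hn]
  simp [this]
  field_simp

theorem kronecker_unitary_normalized {ι κ : Type} [Fintype ι] [DecidableEq ι] [Fintype κ]
    [DecidableEq κ] (U : Matrix.unitaryGroup κ ℂ) {Ψ : ι × κ → ℂ} (hΨ : star Ψ ⬝ᵥ Ψ = 1) :
    star (((1 : Matrix ι ι ℂ) ⊗ₖ (U : Matrix κ κ ℂ)).mulVec Ψ) ⬝ᵥ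
      ((1 : Matrix ι ι ℂ) ⊗ₖ (U : Matrix κ κ ℂ)).mulVec Ψ = 1 := by
  have hU : (U : Matrix κ κ ℂ).conjTranspose * (U : Matrix κ κ ℂ) = 1 :=
    Matrix.UnitaryGroup.star_mul_self U
  rw [Matrix.star_mulVec, Matrix.dotProduct_mulVec, Matrix.vecMul_vecMul,
    Matrix.conjTranspose_kronecker, ← Matrix.mul_kronecker_mul, hU]
  simp [hΨ]

theorem localDist_nonneg (d : ℕ) (Ψ : HonestIdx H × DishonestIdx H d → ℂ) :
    0 ≤ localDist H d Ψ :=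
  Real.iInf_nonneg fun _ => pureDist_nonneg _ _

/-- Every unitary on the dishonest space gives an upper bound on the local distance. -/
theorem localDist_sq_le [NeZero n] (d : ℕ)
    {Ψ : HonestIdx H × DishonestIdx H d → ℂ}
    (hΨ : star Ψ ⬝ᵥ Ψ = 1) (U : Matrix.unitaryGroup (DishonestIdx H d) ℂ) :
    localDist H d Ψ ^ 2 ≤ 1 - (2 ^ (n - 1))⁻¹ / 4 * ‖
      star (dishonestPhase H d Complex.I) ⬝ᵥ (U : Matrix (DishonestIdx H d) (DishonestIdx H d) ℂ).mulVec
        (contract (fun z => (-Complex.I) ^ wt z) Ψ) +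
      star (dishonestPhase H d (-Complex.I)) ⬝ᵥ (U : Matrix (DishonestIdx H d) (DishonestIdx H d) ℂ).mulVec
        (contract (fun z => Complex.I ^ wt z) Ψ)‖ ^ 2 := by
  have h1 : localDist H d Ψ ≤ pureDist (((1 : Matrix (HonestIdx H) (HonestIdx H) ℂ) ⊗ₖ
      (U : Matrix (DishonestIdx H d) (DishonestIdx H d) ℂ)).mulVec Ψ) (target H d) :=
    ciInf_le ⟨0, by rintro _ ⟨V, rfl⟩; exact pureDist_nonneg _ _⟩ U
  have h2 := pureDist_sq_le (kronecker_unitary_normalized (ι := HonestIdx H) U hΨ)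
    (sum_target_sq H d)
  refine (pow_le_pow_left₀ (localDist_nonneg H d Ψ) h1 2).trans (h2.trans (le_of_eq ?_))
  rw [star_target_dotProduct, contract_one_kronecker_mulVec, contract_one_kronecker_mulVec,
    norm_mul, mul_pow, norm_div, Complex.norm_real, Real.norm_eq_abs, div_pow, sq_abs, inv_pow,
    Real.sq_sqrt (by positivity)]
  norm_num

end Target

/-! ## Bessel inequality for the phase vectors -/

theorem norm_sum_phase_sq_le {ι : Type} [Fintype ι] [DecidableEq ι] [Nonempty ι]
    (f : Bits ι → ℂ) :
    ‖∑ z, Complex.I ^ wt z * f z‖ ^ 2 + ‖∑ z, (-Complex.I) ^ wt z * f z‖ ^ 2 ≤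
      2 ^ Fintype.card ι * ∑ z, ‖f z‖ ^ 2 := by
  set K : ℝ := 2 ^ Fintype.card ι with hK
  have hK0 : 0 < K := by positivity
  have hcard : ∑ _z : Bits ι, (1 : ℂ) = K := by simp [hK]
  have hsK : (√K : ℂ) ≠ 0 := by exact_mod_cast (Real.sqrt_pos.mpr hK0).ne'
  have hsK2 : (√K : ℂ) * √K = K := by exact_mod_cast Real.mul_self_sqrt hK0.le
  set v : Fin 2 → EuclideanSpace ℂ (Bits ι) := fun i => (√K : ℂ)⁻¹ • WithLp.toLp 2
    fun z => if i = 0 then (-Complex.I) ^ wt z else Complex.I ^ wt z with hv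
  have hinner : ∀ i j, inner ℂ (v i) (v j) = if i = j then (1 : ℂ) else 0 := by
    intro i j
    have h1 : ∀ w : ℕ, Complex.I ^ w * (-Complex.I) ^ w = 1 := fun w => by rw [← mul_pow]; simp
    have h2 : ∀ w : ℕ, (-Complex.I) ^ w * Complex.I ^ w = 1 := fun w => by rw [← mul_pow]; simp
    have h3 : ∀ w : ℕ, Complex.I ^ w * Complex.I ^ w = (-1) ^ w := fun w => by
      rw [← mul_pow]; simp
    have h4 : ∀ w : ℕ, (-Complex.I) ^ w * (-Complex.I) ^ w = (-1) ^ w := fun w => by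
      rw [← mul_pow]; simp
    simp only [hv, inner_smul_left, inner_smul_right, EuclideanSpace.inner_toLp_toLp, dotProduct,
      map_inv₀, Complex.conj_ofReal]
    fin_cases i <;> fin_cases j <;>
      simp [h1, h2, h3, h4, -Finset.sum_const, hcard, sum_neg_one_pow_wt] <;>
      field_simp <;> rw [pow_two, hsK2]
  have ho : Orthonormal ℂ v := orthonormal_iff_ite.mpr hinner
  have h := ho.sum_inner_products_le (x := WithLp.toLp 2 f) (s := Finset.univ)
  rw [Fin.sum_univ_two, EuclideanSpace.norm_sq_eq] at h
  have e0 : inner ℂ (v 0) (WithLp.toLp 2 f) = (√K : ℂ)⁻¹ * ∑ z, Complex.I ^ wt z * f z := by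
    simp [hv, EuclideanSpace.inner_toLp_toLp, dotProduct, mul_comm]
  have e1 : inner ℂ (v 1) (WithLp.toLp 2 f) = (√K : ℂ)⁻¹ * ∑ z, (-Complex.I) ^ wt z * f z := by
    simp [hv, EuclideanSpace.inner_toLp_toLp, dotProduct, mul_comm]
  rw [e0, e1, norm_mul, norm_mul, mul_pow, mul_pow, norm_inv, Complex.norm_real, Real.norm_eq_abs,
    inv_pow, sq_abs, Real.sq_sqrt hK0.le, ← mul_add, inv_mul_le_iff₀ hK0] at h
  exact h

theorem re_star_dotProduct_self {κ : Type} [Fintype κ] (x : κ → ℂ) :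
    (star x ⬝ᵥ x).re = ∑ b, ‖x b‖ ^ 2 := by
  rw [dotProduct_self_re, EuclideanSpace.norm_sq_eq]

theorem contract_sq_add_contract_sq_le {ι κ : Type} [Fintype ι] [DecidableEq ι] [Nonempty ι]
    [Fintype κ] (Ψ : Bits ι × κ → ℂ) :
    (star (contract (fun z => Complex.I ^ wt z) Ψ) ⬝ᵥ contract (fun z => Complex.I ^ wt z) Ψ).re +
    (star (contract (fun z => (-Complex.I) ^ wt z) Ψ) ⬝ᵥ
      contract (fun z => (-Complex.I) ^ wt z) Ψ).re ≤
      2 ^ Fintype.card ι * (star Ψ ⬝ᵥ Ψ).re := by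
  simp only [re_star_dotProduct_self, Fintype.sum_prod_type_right, ← Finset.sum_add_distrib]
  rw [Finset.mul_sum]
  exact Finset.sum_le_sum fun b _ => norm_sum_phase_sq_le fun z => Ψ (z, b)

/-! ## The probability of passing the test -/

section PassProb

variable {n S : ℕ} {H : Finset (Fin n)}

/-- The observable `∑ᵥ (-1)ʷᵗ⁽ᵛ⁾ E(v)` associated with the parity of the announced bits. -/
def Povm.parity {ι κ : Type} [Fintype ι] [DecidableEq ι] [Fintype κ] [DecidableEq κ]
    (E : Povm κ (Bits ι)) : Matrix κ κ ℂ :=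
  ∑ v, (-1 : ℂ) ^ wt v • E.effect v

theorem Povm.one_sub_parity_posSemidef {ι κ : Type} [Fintype ι] [DecidableEq ι] [Fintype κ]
    [DecidableEq κ] (E : Povm κ (Bits ι)) : (1 - E.parity).PosSemidef := by
  rw [← E.sum_eq_one, Povm.parity, ← Finset.sum_sub_distrib]
  refine Matrix.posSemidef_sum _ fun v _ => ?_
  rcases neg_one_pow_eq_or ℂ (wt v) with h | h <;> rw [h]
  · simpa using Matrix.PosSemidef.zero
  · simpa using (E.posSemidef v).add (E.posSemidef v)

theorem Povm.one_add_parity_posSemidef {ι κ : Type} [Fintype ι] [DecidableEq ι] [Fintype κ]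
    [DecidableEq κ] (E : Povm κ (Bits ι)) : (1 + E.parity).PosSemidef := by
  rw [← E.sum_eq_one, Povm.parity, ← Finset.sum_add_distrib]
  refine Matrix.posSemidef_sum _ fun v _ => ?_
  rcases neg_one_pow_eq_or ℂ (wt v) with h | h <;> rw [h]
  · simpa using (E.posSemidef v).add (E.posSemidef v)
  · simpa using Matrix.PosSemidef.zero

/-- The (unnormalized) state of the dishonest parties correlated with the phases `cʷᵗ⁽ᶻ⁾`. -/
noncomputable abbrev Attack.phaseState (A : Attack n S H) (c : ℂ) : DishonestIdx H A.d → ℂ :=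
  contract (fun z => c ^ wt z) A.state

/-- The probability that the test passes. -/
noncomputable def Attack.passProb (A : Attack n S H) (r : Bits (Fin S)) (i : Fin n) : ℝ :=
  open Classical in
  ∑ x : Bits (Fin n), if wt x % 2 = 0 then (2 ^ (n - 1))⁻¹ *
    ∑ y, (if Accepts x y then A.bornProb r i x (honestPart H y) (dishonestPart H y) else 0) else 0

theorem Attack.ofReal_bornProb (A : Attack n S H) (r : Bits (Fin S)) (i : Fin n)
    (x : Bits (Fin n)) (u : Bits {j : Fin n // j ∈ H}) (v : Bits {j : Fin n // j ∉ H}) :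
    (A.bornProb r i x u v : ℂ) = star (fun b => A.rotated x (u, b)) ⬝ᵥ
      ((A.meas r i (dishonestPart H x)).effect v).mulVec (fun b => A.rotated x (u, b)) := by
  refine Complex.ext rfl ?_
  exact (((A.meas r i (dishonestPart H x)).posSemidef v).1.im_star_dotProduct_mulVec_self _).symm

theorem ite_accepts (x y : Bits (Fin n)) (hx : wt x % 2 = 0) [Decidable (Accepts x y)] :
    (if Accepts x y then (1 : ℝ) else 0) = 1 / 2 + 1 / 2 * ((Complex.I ^ wt x).re * (-1) ^ wt y) := by
  have h2 : wt x = 2 * (wt x / 2) := by omega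
  have h : (Complex.I ^ wt x).re = (-1) ^ (wt x / 2) := by
    conv_lhs => rw [h2]
    rw [pow_mul, Complex.I_sq]
    rw [show (-1 : ℂ) ^ (wt x / 2) = (((-1) ^ (wt x / 2) : ℝ) : ℂ) by push_cast; rfl,
      Complex.ofReal_re]
  rw [h, ← pow_add]
  split_ifs with hA
  · have : Even (wt x / 2 + wt y) := by
      rw [Nat.even_iff]
      have : wt y % 2 = wt x / 2 % 2 := hA
      omega
    rw [this.neg_one_pow]; norm_num
  · have : Odd (wt x / 2 + wt y) := by
      rw [Nat.odd_iff]
      have : ¬ wt y % 2 = wt x / 2 % 2 := hA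
      omega
    rw [this.neg_one_pow]; norm_num

theorem I_pow_re_of_odd {w : ℕ} (hw : ¬ w % 2 = 0) : (Complex.I ^ w).re = 0 := by
  have h2 : w = 2 * (w / 2) + 1 := by omega
  rw [h2, pow_succ, pow_mul, Complex.I_sq]
  rcases neg_one_pow_eq_or ℂ (w / 2) with h | h <;> rw [h] <;> simp

theorem sum_ite_even_wt [NeZero n] :
    ∑ x : Bits (Fin n), (if wt x % 2 = 0 then (1 : ℝ) else 0) = 2 ^ (n - 1) := by
  have h : ∀ x : Bits (Fin n), (if wt x % 2 = 0 then (1 : ℝ) else 0) =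
      1 / 2 + 1 / 2 * (-1) ^ wt x := by
    intro x
    split_ifs with hx
    · rw [(Nat.even_iff.mpr hx).neg_one_pow]; norm_num
    · rw [(Nat.not_even_iff_odd.mp fun h => hx (Nat.even_iff.mp h)).neg_one_pow]; norm_num
  simp only [h]
  rw [Finset.sum_add_distrib, ← Finset.mul_sum, sum_neg_one_pow_wt]
  have hn : n = n - 1 + 1 := (Nat.succ_pred_eq_of_ne_zero (NeZero.ne n)).symm
  have : (2 : ℝ) ^ n = 2 ^ (n - 1) * 2 := by rw [← pow_succ, ← hn]
  simp [this]

theorem Attack.passProb_eq [NeZero n] (A : Attack n S H) (r : Bits (Fin S)) (i : Fin n) :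
    A.passProb r i = 1 / 2 + (2 ^ n)⁻¹ * ∑ w : Bits {j : Fin n // j ∉ H}, (Complex.I ^ wt w *
      (star (A.phaseState (-Complex.I)) ⬝ᵥ
        (A.meas r i w).parity.mulVec (A.phaseState Complex.I))).re := by
  have hn : n = n - 1 + 1 := (Nat.succ_pred_eq_of_ne_zero (NeZero.ne n)).symm
  have h2n : (2 : ℝ) ^ n = 2 ^ (n - 1) * 2 := by rw [← pow_succ, ← hn]
  have hpos : (2 : ℝ) ^ (n - 1) ≠ 0 := by positivity
  -- the signed sum of the Born probabilities
  set C : Bits (Fin n) → ℝ := fun x => ∑ y, (-1) ^ wt y *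
    A.bornProb r i x (honestPart H y) (dishonestPart H y) with hC
  have h1 : A.passProb r i = 1 / 2 + (2 ^ n)⁻¹ * ∑ x, (Complex.I ^ wt x).re * C x := by
    have hterm : ∀ x : Bits (Fin n), (if wt x % 2 = 0 then ((2 : ℝ) ^ (n - 1))⁻¹ *
        ∑ y, (open Classical in if Accepts x y then
          A.bornProb r i x (honestPart H y) (dishonestPart H y) else 0) else 0) =
        (2 ^ n)⁻¹ * (if wt x % 2 = 0 then (1 : ℝ) else 0) +
          (2 ^ n)⁻¹ * ((Complex.I ^ wt x).re * C x) := by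
      intro x
      split_ifs with hx
      · have hone : ∑ y, A.bornProb r i x (honestPart H y) (dishonestPart H y) = 1 := by
          rw [sum_join H (A.bornProb r i x), A.bornProb_sum]
        have : ∑ y, (open Classical in if Accepts x y then
            A.bornProb r i x (honestPart H y) (dishonestPart H y) else 0) =
            1 / 2 + 1 / 2 * ((Complex.I ^ wt x).re * C x) := by
          classical
          calc _ = ∑ y, (if Accepts x y then (1 : ℝ) else 0) *
                A.bornProb r i x (honestPart H y) (dishonestPart H y) := by
                simp [ite_mul]
            _ = ∑ y, (1 / 2 * A.bornProb r i x (honestPart H y) (dishonestPart H y) +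
                1 / 2 * ((Complex.I ^ wt x).re * ((-1) ^ wt y *
                  A.bornProb r i x (honestPart H y) (dishonestPart H y)))) := by
                refine Finset.sum_congr rfl fun y _ => ?_
                rw [ite_accepts x y hx]
                ring
            _ = _ := by
                rw [Finset.sum_add_distrib, ← Finset.mul_sum, hone, ← Finset.mul_sum,
                  ← Finset.mul_sum, mul_one]
        rw [this, h2n]
        field_simp
      · rw [I_pow_re_of_odd hx]
        simp
    rw [Attack.passProb]
    simp only [hterm]
    rw [Finset.sum_add_distrib, ← Finset.mul_sum, ← Finset.mul_sum, sum_ite_even_wt, h2n]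
    field_simp
  rw [h1]
  congr 2
  have hCc : ∀ x, (C x : ℂ) = ∑ u : HonestIdx H, (-1) ^ wt u *
      (star (fun b => A.rotated x (u, b)) ⬝ᵥ
        (A.meas r i (dishonestPart H x)).parity.mulVec (fun b => A.rotated x (u, b))) := by
    intro x
    have : C x = ∑ u, ∑ v, (-1) ^ (wt u + wt v) * A.bornProb r i x u v := by
      rw [← sum_honestPart_dishonestPart H
        fun u v => (-1) ^ (wt u + wt v) * A.bornProb r i x u v]
      exact Finset.sum_congr rfl fun y _ => by rw [← wt_eq_add]
    rw [this]
    push_cast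
    refine Finset.sum_congr rfl fun u _ => ?_
    rw [Povm.parity, Matrix.sum_mulVec, dotProduct_sum, Finset.mul_sum]
    refine Finset.sum_congr rfl fun v _ => ?_
    rw [Matrix.smul_mulVec, dotProduct_smul, smul_eq_mul, A.ofReal_bornProb, pow_add, mul_assoc]
  have h3 : ∀ x, (Complex.I ^ wt x).re * C x = (Complex.I ^ wt x * (C x : ℂ)).re := fun x => by
    rw [Complex.re_mul_ofReal]
  simp only [h3]
  rw [← Complex.re_sum, ← Complex.re_sum]
  congr 1
  set F : HonestIdx H → Bits {j : Fin n // j ∉ H} → ℂ := fun x' w =>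
    Complex.I ^ wt w * (Complex.I ^ wt x' * ∑ u : HonestIdx H, (-1) ^ wt u *
      (star (fun b => (gates x' ⊗ₖ (1 : Matrix (DishonestIdx H A.d) (DishonestIdx H A.d) ℂ)).mulVec
        A.state (u, b)) ⬝ᵥ (A.meas r i w).parity.mulVec
        (fun b => (gates x' ⊗ₖ (1 : Matrix (DishonestIdx H A.d) (DishonestIdx H A.d) ℂ)).mulVec
        A.state (u, b)))) with hF
  have h4 : ∀ x : Bits (Fin n), Complex.I ^ wt x * (C x : ℂ) =
      F (honestPart H x) (dishonestPart H x) := by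
    intro x
    rw [hCc, wt_eq_add H x, pow_add, hF]
    simp only [Attack.rotated]
    ring
  rw [Finset.sum_congr rfl fun x _ => h4 x, sum_honestPart_dishonestPart, Finset.sum_comm]
  refine Finset.sum_congr rfl fun w _ => ?_
  rw [hF, ← Finset.mul_sum, sum_phase_expectation]

end PassProb

section TestBound

variable {n S : ℕ} {H : Finset (Fin n)}

theorem two_mul_add_le {h s t D : ℝ} (hh : 0 ≤ h) (hD : 0 ≤ D) (hDh : D ≤ h)
    (e : s ^ 2 + t ^ 2 = h ^ 2 + D ^ 2) : 2 * (s + t) ≤ 3 * h + D := by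
  refine le_of_sq_le_sq ?_ (by positivity)
  nlinarith [sq_nonneg (s - t), mul_nonneg (sub_nonneg.mpr hDh) (by positivity : 0 ≤ h + 7 * D)]

theorem norm_star_dotProduct_sq_le {κ : Type} [Fintype κ] (x y : κ → ℂ) :
    ‖star x ⬝ᵥ y‖ ^ 2 ≤ (star x ⬝ᵥ x).re * (star y ⬝ᵥ y).re := by
  rw [dotProduct_self_re, dotProduct_self_re, dotProduct_eq_inner, ← mul_pow]
  exact pow_le_pow_left₀ (norm_nonneg _) (norm_inner_le_norm _ _) 2

theorem four_mul_sqrt_add_sqrt_le {A C : ℝ} (hA : 0 ≤ A) (hC : 0 ≤ C) {γ : ℂ}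
    (hγ : ‖γ‖ ^ 2 ≤ A * C) : 4 * (√(A * C - γ.im ^ 2) + √(A * C - γ.re ^ 2)) ≤
      3 * (A + C) + 2 * √(A * C - ‖γ‖ ^ 2) := by
  have hn : ‖γ‖ ^ 2 = γ.re ^ 2 + γ.im ^ 2 := by
    rw [← Complex.normSq_eq_norm_sq, Complex.normSq_apply]; ring
  have h := two_mul_add_le (h := √A * √C) (s := √(A * C - γ.im ^ 2)) (t := √(A * C - γ.re ^ 2))
    (D := √(A * C - ‖γ‖ ^ 2)) (by positivity) (by positivity)
    (by rw [← Real.sqrt_mul hA]; exact Real.sqrt_le_sqrt (by linarith [sq_nonneg ‖γ‖]))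
    (by
      rw [Real.sq_sqrt (by nlinarith [sq_nonneg γ.re]), Real.sq_sqrt (by nlinarith [sq_nonneg γ.im]),
        Real.sq_sqrt (by linarith), mul_pow, Real.sq_sqrt hA, Real.sq_sqrt hC]
      linarith)
  nlinarith [sq_nonneg (√A - √C), Real.sq_sqrt hA, Real.sq_sqrt hC]

theorem re_I_pow_mul_le (w : ℕ) (q : ℂ) {s t : ℝ} (hs : q.re ^ 2 ≤ s) (ht : q.im ^ 2 ≤ t) :
    (Complex.I ^ w * q).re ≤ (√s + √t) / 2 + (-1) ^ w * ((√s - √t) / 2) := by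
  have h1 := abs_le.mp (Real.abs_le_sqrt hs)
  have h2 := abs_le.mp (Real.abs_le_sqrt ht)
  rcases Nat.even_or_odd w with hw | hw
  · rw [hw.neg_one_pow]
    obtain ⟨m, rfl⟩ := hw
    rw [← two_mul, pow_mul, Complex.I_sq]
    rcases neg_one_pow_eq_or ℂ m with h | h <;> rw [h] <;> simp <;> linarith
  · rw [hw.neg_one_pow]
    obtain ⟨m, rfl⟩ := hw
    rw [pow_succ, pow_mul, Complex.I_sq]
    rcases neg_one_pow_eq_or ℂ m with h | h <;> rw [h] <;> simp <;> linarith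

theorem Attack.phaseState_sq_add_le (A : Attack n S H) (hH : H.Nonempty) :
    (star (A.phaseState Complex.I) ⬝ᵥ A.phaseState Complex.I).re +
      (star (A.phaseState (-Complex.I)) ⬝ᵥ A.phaseState (-Complex.I)).re ≤ 2 ^ H.card := by
  have : Nonempty {j : Fin n // j ∈ H} := hH.to_subtype
  have h := contract_sq_add_contract_sq_le A.state
  rw [A.normalized] at h
  simpa using h

theorem Attack.passProb_le_of_dishonest [NeZero n] [Nonempty {j : Fin n // j ∉ H}]
    (A : Attack n S H) (hH : H.Nonempty) (r : Bits (Fin S)) (i : Fin n) :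
    A.passProb r i ≤ 1 - localDist H A.d A.state ^ 2 / 4 := by
  set p := A.phaseState Complex.I with hp
  set m := A.phaseState (-Complex.I) with hm
  have hT := A.phaseState_sq_add_le hH
  rw [← hp, ← hm] at hT
  have hA : 0 ≤ (star p ⬝ᵥ p).re := (Complex.nonneg_iff.mp (dotProduct_star_self_nonneg p)).1
  have hC : 0 ≤ (star m ⬝ᵥ m).re := (Complex.nonneg_iff.mp (dotProduct_star_self_nonneg m)).1
  have hγ : ‖star m ⬝ᵥ p‖ ^ 2 ≤ (star p ⬝ᵥ p).re * (star m ⬝ᵥ m).re := by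
    rw [mul_comm]; exact norm_star_dotProduct_sq_le m p
  have hmain := four_mul_sqrt_add_sqrt_le hA hC hγ
  have hpass := A.passProb_eq r i
  rw [← hp, ← hm] at hpass
  have hcard : H.card ≤ n := by simpa using H.card_le_univ
  have hn : n = n - 1 + 1 := (Nat.succ_pred_eq_of_ne_zero (NeZero.ne n)).symm
  have h2n : (2 : ℝ) ^ n = 2 ^ (n - 1) * 2 := by rw [← pow_succ, ← hn]
  have h2k : (2 : ℝ) ^ n = 2 ^ (n - H.card) * 2 ^ H.card := by
    rw [← pow_add, Nat.sub_add_cancel hcard]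
  set L : ℝ := 2 ^ (n - H.card) with hL
  set K : ℝ := 2 ^ H.card with hK
  have hL0 : 0 < L := by positivity
  have hK0 : 0 < K := by positivity
  set s := √((star p ⬝ᵥ p).re * (star m ⬝ᵥ m).re - (star m ⬝ᵥ p).im ^ 2) with hs
  set t := √((star p ⬝ᵥ p).re * (star m ⬝ᵥ m).re - (star m ⬝ᵥ p).re ^ 2) with ht
  have hsum : ∑ w : Bits {j : Fin n // j ∉ H}, (Complex.I ^ wt w *
      (star m ⬝ᵥ (A.meas r i w).parity.mulVec p)).re ≤ L * ((s + t) / 2) := by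
    calc _ ≤ ∑ w : Bits {j : Fin n // j ∉ H}, ((s + t) / 2 + (-1) ^ wt w * ((s - t) / 2)) :=
          Finset.sum_le_sum fun w _ => re_I_pow_mul_le _ _
            (re_sq_le_sub_im_sq (A.meas r i w).one_sub_parity_posSemidef
              (A.meas r i w).one_add_parity_posSemidef m p)
            (im_sq_le_sub_re_sq (A.meas r i w).one_sub_parity_posSemidef
              (A.meas r i w).one_add_parity_posSemidef m p)
      _ = L * ((s + t) / 2) := by
          rw [Finset.sum_add_distrib, ← Finset.sum_mul, sum_neg_one_pow_wt]
          simp [hL, Fintype.card_subtype_compl]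
  -- the unitary bringing the state close to the target
  have hunit : ∀ c : ℂ, star c * c = 1 →
      star ((√L : ℂ)⁻¹ • dishonestPhase H A.d c) ⬝ᵥ ((√L : ℂ)⁻¹ • dishonestPhase H A.d c) = 1 := by
    intro c hc
    have hsL : (√L : ℂ) * √L = 2 ^ (n - H.card) := by
      rw [← Complex.ofReal_mul, Real.mul_self_sqrt hL0.le, hL]
      push_cast
      rfl
    rw [star_smul, smul_dotProduct, dotProduct_smul, dotProduct_dishonestPhase_self H A.d hc,
      smul_eq_mul, smul_eq_mul, ← hsL]
    have : (√L : ℂ) ≠ 0 := by exact_mod_cast (Real.sqrt_pos.mpr hL0).ne'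
    simp only [star_inv₀, RCLike.star_def, Complex.conj_ofReal]
    field_simp
  obtain ⟨U, hU⟩ := exists_unitary_overlap p m ((√L : ℂ)⁻¹ • dishonestPhase H A.d (-Complex.I))
    ((√L : ℂ)⁻¹ • dishonestPhase H A.d Complex.I) (hunit _ (by simp)) (hunit _ (by simp)) (by
      rw [star_smul, smul_dotProduct, dotProduct_smul,
        dotProduct_dishonestPhase_of_eq_neg_one H A.d (by simp), smul_zero, smul_zero])
  have hdist := localDist_sq_le H A.d A.normalized U
  rw [star_smul, star_smul, smul_dotProduct, smul_dotProduct, ← smul_add, norm_smul, mul_pow,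
    add_comm (star (dishonestPhase H A.d (-Complex.I)) ⬝ᵥ _)] at hU
  have hsl : ‖star (√L : ℂ)⁻¹‖ ^ 2 = L⁻¹ := by
    rw [norm_star, norm_inv, Complex.norm_real, Real.norm_eq_abs, inv_pow, sq_abs,
      Real.sq_sqrt hL0.le]
  rw [hsl] at hU
  change localDist H A.d A.state ^ 2 ≤ 1 - (2 ^ (n - 1))⁻¹ / 4 * ‖
      star (dishonestPhase H A.d Complex.I) ⬝ᵥ
        (U : Matrix (DishonestIdx H A.d) (DishonestIdx H A.d) ℂ).mulVec m +
      star (dishonestPhase H A.d (-Complex.I)) ⬝ᵥ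
        (U : Matrix (DishonestIdx H A.d) (DishonestIdx H A.d) ℂ).mulVec p‖ ^ 2 at hdist
  set F : ℝ := ‖star (dishonestPhase H A.d Complex.I) ⬝ᵥ
        (U : Matrix (DishonestIdx H A.d) (DishonestIdx H A.d) ℂ).mulVec m +
      star (dishonestPhase H A.d (-Complex.I)) ⬝ᵥ
        (U : Matrix (DishonestIdx H A.d) (DishonestIdx H A.d) ℂ).mulVec p‖ ^ 2
  set D := √((star p ⬝ᵥ p).re * (star m ⬝ᵥ m).re - ‖star m ⬝ᵥ p‖ ^ 2)
  have hn1 : (2 : ℝ) ^ (n - 1) = L * K / 2 := by linarith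
  have hF : (2 ^ (n - 1))⁻¹ / 4 * F = L⁻¹ * F / (2 * K) := by
    rw [hn1]
    field_simp
    ring
  have hF' : ((star p ⬝ᵥ p).re + (star m ⬝ᵥ m).re + 2 * D) / (2 * K) ≤ L⁻¹ * F / (2 * K) := by
    gcongr
  have hP : A.passProb r i ≤ 1 / 2 + (s + t) / (2 * K) := by
    rw [hpass]
    have : (2 ^ n : ℝ)⁻¹ * (L * ((s + t) / 2)) = (s + t) / (2 * K) := by
      rw [h2k]
      field_simp
    rw [← this]
    gcongr
  have hfin : (s + t) / (2 * K) ≤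
      1 / 4 + ((star p ⬝ᵥ p).re + (star m ⬝ᵥ m).re + 2 * D) / (2 * K) / 4 := by
    rw [div_le_iff₀ (by positivity)]
    have : (1 / 4 + ((star p ⬝ᵥ p).re + (star m ⬝ᵥ m).re + 2 * D) / (2 * K) / 4) * (2 * K) =
        K / 2 + ((star p ⬝ᵥ p).re + (star m ⬝ᵥ m).re + 2 * D) / 4 := by
      field_simp
      ring
    rw [this]
    linarith
  linarith

theorem Attack.passProb_le_of_isEmpty [NeZero n] [IsEmpty {j : Fin n // j ∉ H}]
    (A : Attack n S H) (r : Bits (Fin S)) (i : Fin n) :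
    A.passProb r i ≤ 1 - localDist H A.d A.state ^ 2 / 4 := by
  have hHu : H = Finset.univ := Finset.eq_univ_iff_forall.mpr fun j => by
    by_contra hj
    exact isEmptyElim (⟨j, hj⟩ : {j : Fin n // j ∉ H})
  have hcard : H.card = n := by rw [hHu]; simp
  have hH : H.Nonempty := by rw [hHu]; exact Finset.univ_nonempty
  have hwt : ∀ w : Bits {j : Fin n // j ∉ H}, wt w = 0 := fun w => by simp [wt]
  set p := A.phaseState Complex.I with hp
  set m := A.phaseState (-Complex.I) with hm
  have hT := A.phaseState_sq_add_le hH
  rw [← hp, ← hm, hcard] at hT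
  have hpar : ∀ w, (A.meas r i w).parity = 1 := by
    intro w
    rw [← (A.meas r i w).sum_eq_one, Povm.parity]
    simp [hwt]
  have hpass := A.passProb_eq r i
  rw [← hp, ← hm] at hpass
  simp only [hpar, hwt, pow_zero, one_mul, Matrix.one_mulVec, Fintype.sum_unique] at hpass
  have hn : n = n - 1 + 1 := (Nat.succ_pred_eq_of_ne_zero (NeZero.ne n)).symm
  have h2n : (2 : ℝ) ^ n = 2 ^ (n - 1) * 2 := by rw [← pow_succ, ← hn]
  have hphase : dishonestPhase H A.d (-Complex.I) = dishonestPhase H A.d Complex.I := by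
    ext b
    simp [dishonestPhase, hwt]
  obtain ⟨U, hU⟩ := exists_unitary_norm_dotProduct (m + p) (dishonestPhase H A.d Complex.I) (by
    rw [dotProduct_dishonestPhase_self H A.d (by simp), hcard]; simp)
  have hdist := localDist_sq_le H A.d A.normalized U
  rw [hphase, ← dotProduct_add, ← Matrix.mulVec_add] at hdist
  have hsymm : (star p ⬝ᵥ m).re = (star m ⬝ᵥ p).re := by
    rw [Matrix.star_dotProduct]; simp
  have hexp : (star (m + p) ⬝ᵥ (m + p)).re =
      (star p ⬝ᵥ p).re + (star m ⬝ᵥ m).re + 2 * (star m ⬝ᵥ p).re := by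
    simp only [star_add, add_dotProduct, dotProduct_add, Complex.add_re, hsymm]
    ring
  have hnn : 2 * (star m ⬝ᵥ p).re ≤ (star p ⬝ᵥ p).re + (star m ⬝ᵥ m).re := by
    have := (Complex.nonneg_iff.mp (dotProduct_star_self_nonneg (m - p))).1
    simp only [star_sub, sub_dotProduct, dotProduct_sub, Complex.sub_re, hsymm] at this
    linarith
  change localDist H A.d A.state ^ 2 ≤ 1 - (2 ^ (n - 1))⁻¹ / 4 *
    ‖star (dishonestPhase H A.d Complex.I) ⬝ᵥ
        (U : Matrix (DishonestIdx H A.d) (DishonestIdx H A.d) ℂ).mulVec (m + p)‖ ^ 2 at hdist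
  rw [hU, hexp] at hdist
  set K : ℝ := 2 ^ n with hK
  have hK0 : 0 < K := by positivity
  have hn1 : (2 : ℝ) ^ (n - 1) = K / 2 := by linarith
  rw [hn1] at hdist
  have e : (K / 2)⁻¹ / 4 * ((star p ⬝ᵥ p).re + (star m ⬝ᵥ m).re + 2 * (star m ⬝ᵥ p).re) =
      K⁻¹ * (((star p ⬝ᵥ p).re + (star m ⬝ᵥ m).re + 2 * (star m ⬝ᵥ p).re) / 2) := by
    field_simp
    ring
  rw [e] at hdist
  have hfin : K⁻¹ * (star m ⬝ᵥ p).re ≤ 1 / 4 + K⁻¹ *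
      (((star p ⬝ᵥ p).re + (star m ⬝ᵥ m).re + 2 * (star m ⬝ᵥ p).re) / 2) / 4 := by
    have : (1 : ℝ) / 4 = K⁻¹ * (K / 4) := by field_simp
    rw [this, mul_div_assoc, ← mul_add]
    exact mul_le_mul_of_nonneg_left (by linarith) (by positivity)
  rw [hpass]
  linarith

/-- A state at local distance `τ` from the GHZ state passes the test of an honest verifier with
probability at most `1 - τ² / 4`. -/
theorem Attack.passProb_le [NeZero n] (A : Attack n S H) (hH : H.Nonempty) (r : Bits (Fin S))
    (i : Fin n) : A.passProb r i ≤ 1 - localDist H A.d A.state ^ 2 / 4 := by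
  rcases isEmpty_or_nonempty {j : Fin n // j ∉ H} with h | h
  · exact A.passProb_le_of_isEmpty r i
  · exact A.passProb_le_of_dishonest hH r i

end TestBound

/-! ## Expectations with respect to probability mass functions -/

section Expectation

/-- The expectation of `f` with respect to `p`. -/
noncomputable def expect {α : Type} (p : PMF α) (f : α → ℝ≥0∞) : ℝ≥0∞ := ∑' a, p a * f a

theorem expect_pure {α : Type} (a : α) (f : α → ℝ≥0∞) : expect (PMF.pure a) f = f a := by
  rw [expect, tsum_eq_single a]
  · simp
  · intro b hb
    simp [PMF.pure_apply, hb]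

theorem expect_bind {α β : Type} (p : PMF α) (q : α → PMF β) (f : β → ℝ≥0∞) :
    expect (p.bind q) f = expect p fun a => expect (q a) f := by
  simp only [expect, PMF.bind_apply, ← ENNReal.tsum_mul_right, ← ENNReal.tsum_mul_left]
  rw [ENNReal.tsum_comm]
  simp only [mul_assoc]

theorem expect_mono {α : Type} (p : PMF α) {f g : α → ℝ≥0∞} (h : ∀ a, f a ≤ g a) :
    expect p f ≤ expect p g :=
  ENNReal.tsum_le_tsum fun a => mul_le_mul_right (h a) _

theorem expect_const {α : Type} (p : PMF α) (c : ℝ≥0∞) : expect p (fun _ => c) = c := by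
  rw [expect, ENNReal.tsum_mul_right, p.tsum_coe, one_mul]

theorem expect_le_of_le {α : Type} (p : PMF α) {f : α → ℝ≥0∞} {c : ℝ≥0∞} (h : ∀ a, f a ≤ c) :
    expect p f ≤ c :=
  (expect_mono p h).trans (expect_const p c).le

theorem toOuterMeasure_le_expect {α : Type} (p : PMF α) (s : Set α) {f : α → ℝ≥0∞}
    (h : ∀ a ∈ s, 1 ≤ f a) : p.toOuterMeasure s ≤ expect p f := by
  rw [PMF.toOuterMeasure_apply, expect]
  refine ENNReal.tsum_le_tsum fun a => ?_
  by_cases ha : a ∈ s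
  · rw [Set.indicator_of_mem ha]
    exact le_mul_of_one_le_right' (h a ha)
  · simp [ha]

theorem expect_uniformOfFintype_ofReal {α : Type} [Fintype α] [Nonempty α] {f : α → ℝ}
    (hf : ∀ a, 0 ≤ f a) : expect (PMF.uniformOfFintype α) (fun a => ENNReal.ofReal (f a)) =
      ENNReal.ofReal ((Fintype.card α : ℝ)⁻¹ * ∑ a, f a) := by
  simp only [expect, PMF.uniformOfFintype_apply, tsum_fintype]
  rw [← Finset.mul_sum, ENNReal.ofReal_mul (by positivity),
    ENNReal.ofReal_sum_of_nonneg fun a _ => hf a,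
    ENNReal.ofReal_inv_of_pos (by exact_mod_cast Fintype.card_pos), ENNReal.ofReal_natCast]

end Expectation

section Protocol

variable {n S : ℕ} {H : Finset (Fin n)}

theorem Attack.passProb_nonneg (A : Attack n S H) (r : Bits (Fin S)) (i : Fin n) :
    0 ≤ A.passProb r i := by
  classical
  refine Finset.sum_nonneg fun x _ => ?_
  split_ifs
  · refine mul_nonneg (by positivity) (Finset.sum_nonneg fun y _ => ?_)
    split_ifs
    · exact A.bornProb_nonneg r i x _ _
    · exact le_rfl
  · exact le_rfl

theorem card_filter_even_wt [NeZero n] :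
    (Finset.univ.filter fun x : Bits (Fin n) => wt x % 2 = 0).card = 2 ^ (n - 1) := by
  have h := sum_ite_even_wt (n := n)
  rw [Finset.sum_boole] at h
  exact_mod_cast h

theorem verifierInputs_apply [NeZero n] (x : Bits (Fin n)) :
    verifierInputs n x = if wt x % 2 = 0 then (2 ^ (n - 1))⁻¹ else 0 := by
  refine (PMF.uniformOfFinset_apply (s := Finset.univ.filter fun x => wt x % 2 = 0) _ x).trans ?_
  rw [card_filter_even_wt]
  simp

open Classical in
theorem Attack.expect_test [NeZero n] (A : Attack n S H) (r : Bits (Fin S)) (i : Fin n)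
    (c : ℝ≥0∞) : expect (verifierInputs n) (fun x => expect (A.outcomes r i x)
      fun y => if Accepts x y then c else 0) = ENNReal.ofReal (A.passProb r i) * c := by
  have h1 : ∀ x, expect (A.outcomes r i x) (fun y => if Accepts x y then c else 0) =
      ENNReal.ofReal (∑ y, if Accepts x y then
        A.bornProb r i x (honestPart H y) (dishonestPart H y) else 0) * c := by
    intro x
    rw [expect, tsum_fintype, ENNReal.ofReal_sum_of_nonneg, Finset.sum_mul]
    · refine Finset.sum_congr rfl fun y _ => ?_
      rw [Attack.outcomes, PMF.ofFintype_apply]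
      split_ifs <;> simp
    · intro y _
      split_ifs
      · exact A.bornProb_nonneg r i x _ _
      · exact le_rfl
  have hnn : ∀ x : Bits (Fin n), 0 ≤ ∑ y, if Accepts x y then
        A.bornProb r i x (honestPart H y) (dishonestPart H y) else 0 := by
    intro x
    refine Finset.sum_nonneg fun y _ => ?_
    split_ifs
    · exact A.bornProb_nonneg r i x _ _
    · exact le_rfl
  rw [Attack.passProb, ENNReal.ofReal_sum_of_nonneg, Finset.sum_mul, expect, tsum_fintype]
  · refine Finset.sum_congr rfl fun x _ => ?_
    rw [h1, ← mul_assoc]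
    congr 1
    rw [verifierInputs_apply]
    split_ifs
    · rw [ENNReal.ofReal_mul (by positivity), ENNReal.ofReal_inv_of_pos (by positivity),
        ENNReal.ofReal_pow (by norm_num)]
      simp
    · simp
  · intro x _
    split_ifs
    · exact mul_nonneg (by positivity) (hnn x)
    · exact le_rfl

open Classical in
/-- An upper bound `B` on the probability of a bad use from each status of the protocol. -/
noncomputable def potential (ε : ℝ) (B : ℝ≥0∞) : Status n S H → ℝ≥0∞
  | .running _ => B
  | .aborted => 0
  | .used A => if ε ≤ localDist H A.d A.state then 1 else 0

theorem sum_ite_eq_zero_bits (a b : ℝ) :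
    ∑ r : Bits (Fin S), (if r = 0 then a else b) = a + (2 ^ S - 1) * b := by
  have h : ∀ r : Bits (Fin S), (if r = 0 then a else b) = b + if r = 0 then a - b else 0 := by
    intro r
    split_ifs <;> ring
  simp only [h]
  rw [Finset.sum_add_distrib, Finset.sum_ite_eq']
  simp
  ring

theorem sum_ite_mem (a b : ℝ) :
    ∑ i : Fin n, (if i ∈ H then a else b) = H.card * a + (n - H.card) * b := by
  have h : ∀ i : Fin n, (if i ∈ H then a else b) = b + if i ∈ H then a - b else 0 := by
    intro r
    split_ifs <;> ring
  simp only [h]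
  rw [Finset.sum_add_distrib, Finset.sum_ite_mem]
  simp
  ring

theorem expect_step_le [NeZero n] (adv : Strategy n S H) {ε : ℝ} (hε : 0 < ε)
    (hH : H.Nonempty) (st : Status n S H) :
    expect (step adv st) (potential ε
      (ENNReal.ofReal ((2 : ℝ)⁻¹ ^ S * (4 * n / (H.card * ε ^ 2))))) ≤
    potential ε (ENNReal.ofReal ((2 : ℝ)⁻¹ ^ S * (4 * n / (H.card * ε ^ 2)))) st := by
  classical
  set B : ℝ := (2 : ℝ)⁻¹ ^ S * (4 * n / (H.card * ε ^ 2)) with hB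
  have hk : (0 : ℝ) < H.card := by exact_mod_cast hH.card_pos
  have hn : (0 : ℝ) < n := by exact_mod_cast Nat.pos_of_ne_zero (NeZero.ne n)
  have hB0 : 0 < B := by positivity
  cases st with
  | aborted => rw [step, expect_pure]
  | used A => rw [step, expect_pure]
  | running past =>
    rw [step, expect_bind]
    refine expect_le_of_le _ fun A => ?_
    rw [expect_bind]
    simp only [expect_bind]
    by_cases hA : ε ≤ localDist H A.d A.state
    · have hτ : ε ^ 2 ≤ localDist H A.d A.state ^ 2 := pow_le_pow_left₀ hε.le hA 2
      have hpass : ∀ r i, A.passProb r i ≤ 1 - ε ^ 2 / 4 := fun r i =>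
        (A.passProb_le hH r i).trans (by linarith)
      have hδ : 0 ≤ 1 - ε ^ 2 / 4 := (A.passProb_nonneg 0 0).trans (hpass 0 0)
      have hle : ∀ (r : Bits (Fin S)) (i : Fin n),
          expect (if r = 0 then PMF.pure (Status.used A)
            else if i ∈ H then
              (verifierInputs n).bind fun x =>
              (A.outcomes r i x).bind fun y =>
              if Accepts x y then PMF.pure (.running (past ++ [⟨A, r, i, some (x, y)⟩]))
              else PMF.pure .aborted
            else PMF.pure (.running (past ++ [⟨A, r, i, none⟩])))
            (potential ε (ENNReal.ofReal B)) ≤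
          ENNReal.ofReal (if r = 0 then 1 else if i ∈ H then (1 - ε ^ 2 / 4) * B else B) := by
        intro r i
        split_ifs with hr hi
        · simp [expect_pure, potential, hA]
        · rw [expect_bind]
          simp only [expect_bind]
          have hy : ∀ x y, expect (if Accepts x y then
              PMF.pure (Status.running (past ++ [⟨A, r, i, some (x, y)⟩])) else
              PMF.pure Status.aborted) (potential ε (ENNReal.ofReal B)) =
              if Accepts x y then ENNReal.ofReal B else 0 := by
            intro x y
            split_ifs <;> simp [expect_pure, potential]
          simp only [hy]
          rw [A.expect_test, ENNReal.ofReal_mul hδ]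
          gcongr
          exact hpass r i
        · simp [expect_pure, potential]
      refine (expect_mono _ fun r => expect_mono _ fun i => hle r i).trans ?_
      have hnn : ∀ (r : Bits (Fin S)) (i : Fin n),
          0 ≤ if r = 0 then 1 else if i ∈ H then (1 - ε ^ 2 / 4) * B else B := by
        intro r i
        split_ifs <;> positivity
      simp only [expect_uniformOfFintype_ofReal (hnn _)]
      rw [expect_uniformOfFintype_ofReal fun r =>
        mul_nonneg (by positivity) (Finset.sum_nonneg fun i _ => hnn r i)]
      refine ENNReal.ofReal_le_ofReal ?_
      have hinner : ∀ r : Bits (Fin S), ((Fintype.card (Fin n) : ℝ))⁻¹ * ∑ i : Fin n,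
          (if r = 0 then 1 else if i ∈ H then (1 - ε ^ 2 / 4) * B else B) =
          if r = 0 then 1 else (1 - H.card * ε ^ 2 / (4 * n)) * B := by
        intro r
        split_ifs
        · simp [hn.ne']
        · rw [sum_ite_mem, Fintype.card_fin]
          field_simp
          ring
      simp only [hinner]
      rw [sum_ite_eq_zero_bits]
      have hcard : (Fintype.card (Bits (Fin S)) : ℝ) = 2 ^ S := by simp
      rw [hcard, inv_mul_le_iff₀ (by positivity)]
      have hBδ : H.card * ε ^ 2 / (4 * n) * B * 2 ^ S = 1 := by
        rw [hB, inv_pow]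
        field_simp
      have hδ1 : H.card * ε ^ 2 / (4 * n) ≤ 1 := by
        rw [div_le_one (by positivity)]
        have : (H.card : ℝ) ≤ n := by exact_mod_cast (by simpa using H.card_le_univ)
        nlinarith
      nlinarith
    · refine expect_le_of_le _ fun r => expect_le_of_le _ fun i => ?_
      split_ifs
      · simp [expect_pure, potential, hA]
      · rw [expect_bind]
        simp only [expect_bind]
        refine expect_le_of_le _ fun x => expect_le_of_le _ fun y => ?_
        split_ifs <;> simp [expect_pure, potential]
      · simp [expect_pure, potential]

theorem expect_run_le [NeZero n] (adv : Strategy n S H) {ε : ℝ} (hε : 0 < ε)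
    (hH : H.Nonempty) (N : ℕ) :
    expect (run adv N) (potential ε
      (ENNReal.ofReal ((2 : ℝ)⁻¹ ^ S * (4 * n / (H.card * ε ^ 2))))) ≤
    ENNReal.ofReal ((2 : ℝ)⁻¹ ^ S * (4 * n / (H.card * ε ^ 2))) := by
  induction N with
  | zero => rw [run, expect_pure, potential]
  | succ N ih =>
    rw [run, expect_bind]
    exact (expect_mono _ fun st => expect_step_le adv hε hH st).trans ih

end Protocol
end GHZ

theorem theorem3 (n k S : ℕ) [NeZero n] (H : Finset (Fin n)) (hcard : H.card = k) (hk : 0 < k)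
    (adv : GHZ.Strategy n S H) (ε : ℝ) (hε : 0 < ε) :
    GHZ.probC adv ε ≤ ENNReal.ofReal ((2 : ℝ)⁻¹ ^ S * (4 * n / (k * ε ^ 2))) := by
  subst hcard
  refine iSup_le fun N => (GHZ.toOuterMeasure_le_expect _ _ ?_).trans
    (GHZ.expect_run_le adv hε (Finset.card_pos.mp hk) N)
  rintro st ⟨A, rfl, hA⟩
  simp [GHZ.potential, hA]
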